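/- Let $(\mathcal C,\otimes,K,c)$ be a braided monoidal category (strict or not; associativity and unit isomorphisms are suppressed) in which every idempotent splits. For an object $M$ write $M$ also for $\mathrm{id}_M$; the convolution of $f,g:H\to H$ is $f*g=\mu_H\circ(f\otimes g)\circ\delta_H$. **Weak Hopf quasigroups.** A weak Hopf quasigroup in $\mathcal C$ is an object $H$ with a unit $\eta_H:K\to H$ and a (not necessarily associative) product $\mu_H:H\otimes H\to H$ with $\mu_H\circ(H\otimes\eta_H)=\mathrm{id}_H=\mu_H\circ(\eta_H\otimes H)$, a coassociative counital coproduct $(\varepsilon_H,\delta_H)$, and an antipode $\lambda_H:H\to H$ such that, with $\Pi^L_H=\mathrm{id}_H*\lambda_H$, $\Pi^R_H=\lambda_H*\mathrm{id}_H$ and $c=c_{H,H}$: 1. $\delta_H\circ\mu_H=(\mu_H\otimes\mu_H)\circ(H\otimes c\otimes H)\circ(\delta_H\otimes\delta_H)$; 2. $\varepsilon_H\circ\mu_H\circ(\mu_H\otimes H)=\varepsilon_H\circ\mu_H\circ(H\otimes\mu_H)=((\varepsilon_H\circ\mu_H)\otimes(\varepsilon_H\circ\mu_H))\circ(H\otimes\delta_H\otimes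 H)=((\varepsilon_H\circ\mu_H)\otimes(\varepsilon_H\circ\mu_H))\circ(H\otimes(c^{-1}\circ\delta_H)\otimes H)$; 3. $(\delta_H\otimes H)\circ\delta_H\circ\eta_H=(H\otimes\mu_H\otimes H)\circ((\delta_H\circ\eta_H)\otimes(\delta_H\circ\eta_H))=(H\otimes(\mu_H\circ c^{-1})\otimes H)\circ((\delta_H\circ\eta_H)\otimes(\delta_H\circ\eta_H))$; 4. $\Pi^L_H=((\varepsilon_H\circ\mu_H)\otimes H)\circ(H\otimes c)\circ((\delta_H\circ\eta_H)\otimes H)$ and $\Pi^R_H=(H\otimes(\varepsilon_H\circ\mu_H))\circ(c\otimes H)\circ(H\otimes(\delta_H\circ\eta_H))$; 5. $\lambda_H*\Pi^L_H=\Pi^R_H*\lambda_H=\lambda_H$; 6. $\mu_H\circ(\lambda_H\otimes\mu_H)\circ(\delta_H\otimes H)=\mu_H\circ(\Pi^R_H\otimes H)$ and $\mu_H\circ(H\otimes\mu_H)\circ(H\otimes\lambda_H\otimes H)\circ(\delta_H\otimes H)=\mu_H\circ(\Pi^L_H\otimes H)$; 7. $\mu_H\circ(\mu_H\otimes\lambda_H)\circ(H\otimes\delta_H)=\mu_H\circ(H\otimes\Pi^L_H)$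 and $\mu_H\circ(\mu_H\otimes H)\circ(H\otimes\lambda_H\otimes H)\circ(H\otimes\delta_H)=\mu_H\circ(H\otimes\Pi^R_H)$. **Hopf modules.** A right-right $H$-Hopf module is a triple $(M,\phi_M:M\otimes H\to M,\rho_M:M\to M\otimes H)$ such that $(M,\rho_M)$ is a (counital, coassociative) right $H$-comodule and - $\phi_M\circ(M\otimes\eta_H)=\mathrm{id}_M$ and $\rho_M\circ\phi_M=(\phi_M\otimes\mu_H)\circ(M\otimes c\otimes H)\circ(\rho_M\otimes\delta_H)$; - $\phi_M\circ(\phi_M\otimes\lambda_H)\circ(M\otimes\delta_H)=\phi_M\circ(M\otimes\Pi^L_H)$; - $\phi_M\circ(\phi_M\otimes H)\circ(M\otimes\lambda_H\otimes H)\circ(M\otimes\delta_H)=\phi_M\circ(M\otimes\Pi^R_H)$; - $\phi_M\circ(\phi_M\otimes H)\circ(M\otimes\Pi^L_H\otimes H)\circ(M\otimes\delta_H)=\phi_M$. **Coinvariants.** Put $q_M=\phi_M\circ(M\otimes\lambda_H)\circ\rho_M:M\to M$. When $q_M$ is split as $q_M=i_M\circ p_M$, $p_M\circ i_M=\mathrm{id}_{M^{coH}}$,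 put $\omega_M=\phi_M\circ(i_M\otimes H)$, $\omega'_M=(p_M\otimes H)\circ\rho_M$ and $\nabla_M=\omega'_M\circ\omega_M:M^{coH}\otimes H\to M^{coH}\otimes H$. When $\nabla_M$ is split as $\nabla_M=i\circ p$, $p\circ i=\mathrm{id}_{M^{coH}\times H}$, put $$\phi_{M^{coH}\times H}=p\circ(M^{coH}\otimes\mu_H)\circ(i\otimes H),\qquad \rho_{M^{coH}\times H}=(p\otimes H)\circ(M^{coH}\otimes\delta_H)\circ i,$$ $\alpha_M=p\circ\omega'_M:M\to M^{coH}\times H$, $\alpha_M^{-1}=\omega_M\circ i$, and $\phi_M^{\alpha_M}=\alpha_M^{-1}\circ\phi_{M^{coH}\times H}\circ(\alpha_M\otimes H)$, where in $\phi_M^{\alpha_M}$ some splittings are fixed for each $M$. **The category $\mathcal M^H_H$.** Its objects are the right-right $H$-Hopf modules. A morphism $f:M\to N$ is a morphism in $\mathcal C$ that is a morphism of right $H$-comodules, $\rho_N\circ f=(f\otimes H)\circ\rho_M$, and is $H$-quasilinear, $\phi_N^{\alpha_N}\circ(f\otimes H)=f\circ\phi_M^{\alpha_M}$. **Theorem (Fundamental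 Theorem of Hopf modules).** Let $H$ be a weak Hopf quasigroup in $\mathcal C$ and $(M,\phi_M,\rho_M)$ a right-right $H$-Hopf module. Then $q_M$ is idempotent; for every splitting of $q_M$ the morphism $\nabla_M$ is idempotent; and for every splitting of $\nabla_M$ the triple $(M^{coH}\times H,\phi_{M^{coH}\times H},\rho_{M^{coH}\times H})$ is a right-right $H$-Hopf module, and $\alpha_M=p\circ(p_M\otimes H)\circ\rho_M$ is an isomorphism in $\mathcal M^H_H$ from $(M,\phi_M,\rho_M)$ to $(M^{coH}\times H,\phi_{M^{coH}\times H},\rho_{M^{coH}\times H})$, with inverse $\omega_M\circ i$. -/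

import Mathlib

open CategoryTheory MonoidalCategory

universe v u

namespace WeakHopf

/-- A unital magma in a monoidal category: an object `A` with a unit `one : 𝟙_ C ⟶ A` and a
product `mul : A ⊗ A ⟶ A`, unital on both sides, not necessarily associative. -/
class UnitalMagmaObj {C : Type u} [Category.{v} C] [MonoidalCategory C] (A : C) where
  one : 𝟙_ C ⟶ A
  mul : A ⊗ A ⟶ A
  one_mul : one ▷ A ≫ mul = (λ_ A).hom
  mul_one : A ◁ one ≫ mul = (ρ_ A).hom

/-- The convolution product `f ∗ g = μ ∘ (f ⊗ g) ∘ δ`. -/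
def conv {C : Type u} [Category.{v} C] [MonoidalCategory C] {A D : C}
    (mul : A ⊗ A ⟶ A) (comul : D ⟶ D ⊗ D) (f g : D ⟶ A) : D ⟶ A :=
  comul ≫ (f ⊗ₘ g) ≫ mul

/-- A weak Hopf quasigroup in a braided monoidal category: a unital magma and a comonoid with an
antipode. Compositions are written in diagrammatic order, and `⊗≫` composes two morphisms after
inserting the associators and unitors that match the bracketings (these are identities in the
strict case). In the field names, `convL` is the target morphism `id ∗ antipode` and `convR` is
the source morphism `antipode ∗ id`. -/
class WeakHopfQuasigroup {C : Type u} [Category.{v} C] [MonoidalCategory C] [BraidedCategory C]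
    (H : C) extends UnitalMagmaObj H, ComonObj H where
  mul_comul : mul ≫ comul = (comul ⊗ₘ comul) ≫ tensorμ H H H H ≫ (mul ⊗ₘ mul)
  counit_assoc : mul ▷ H ≫ mul ≫ counit = (α_ H H H).hom ≫ H ◁ mul ≫ mul ≫ counit
  counit_weak : mul ▷ H ≫ mul ≫ counit =
    (H ◁ comul) ▷ H ⊗≫ ((mul ≫ counit) ⊗ₘ (mul ≫ counit)) ≫ (λ_ (𝟙_ C)).hom
  counit_weak_braided : mul ▷ H ≫ mul ≫ counit =
    (H ◁ (comul ≫ (β_ H H).inv)) ▷ H ⊗≫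
      ((mul ≫ counit) ⊗ₘ (mul ≫ counit)) ≫ (λ_ (𝟙_ C)).hom
  unit_weak : one ≫ comul ≫ comul ▷ H =
    (λ_ (𝟙_ C)).inv ≫ ((one ≫ comul) ⊗ₘ (one ≫ comul)) ⊗≫ (H ◁ mul) ▷ H
  unit_weak_braided : one ≫ comul ≫ comul ▷ H =
    (λ_ (𝟙_ C)).inv ≫ ((one ≫ comul) ⊗ₘ (one ≫ comul)) ⊗≫ (H ◁ ((β_ H H).inv ≫ mul)) ▷ H
  /-- The antipode. -/
  antipode : H ⟶ H
  convL_eq : conv mul comul (𝟙 H) antipode =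
    (λ_ H).inv ≫ (one ≫ comul) ▷ H ⊗≫ H ◁ (β_ H H).hom ⊗≫ (mul ≫ counit) ▷ H ≫ (λ_ H).hom
  convR_eq : conv mul comul antipode (𝟙 H) =
    (ρ_ H).inv ≫ H ◁ (one ≫ comul) ⊗≫ (β_ H H).hom ▷ H ⊗≫ H ◁ (mul ≫ counit) ≫ (ρ_ H).hom
  antipode_convL : conv mul comul antipode (conv mul comul (𝟙 H) antipode) = antipode
  convR_antipode : conv mul comul (conv mul comul antipode (𝟙 H)) antipode = antipode
  antipode_mul_left : comul ▷ H ⊗≫ (antipode ⊗ₘ mul) ≫ mul =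
    conv mul comul antipode (𝟙 H) ▷ H ≫ mul
  mul_antipode_left : comul ▷ H ⊗≫ H ◁ (antipode ▷ H) ≫ H ◁ mul ≫ mul =
    conv mul comul (𝟙 H) antipode ▷ H ≫ mul
  mul_antipode_right : H ◁ comul ⊗≫ (mul ⊗ₘ antipode) ≫ mul =
    H ◁ conv mul comul (𝟙 H) antipode ≫ mul
  antipode_mul_right : H ◁ comul ⊗≫ (H ◁ antipode) ▷ H ≫ mul ▷ H ≫ mul =
    H ◁ conv mul comul antipode (𝟙 H) ≫ mul

section

variable {C : Type u} [Category.{v} C] [MonoidalCategory C] [BraidedCategory C]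
variable (H : C) [WeakHopfQuasigroup H]

/-- The unit `η_H`. -/
abbrev unit : 𝟙_ C ⟶ H := UnitalMagmaObj.one

/-- The product `μ_H`. -/
abbrev mul : H ⊗ H ⟶ H := UnitalMagmaObj.mul

/-- The counit `ε_H`. -/
abbrev counit : H ⟶ 𝟙_ C := ComonObj.counit

/-- The coproduct `δ_H`. -/
abbrev comul : H ⟶ H ⊗ H := ComonObj.comul

/-- The antipode `λ_H`. -/
abbrev antipode : H ⟶ H := WeakHopfQuasigroup.antipode

/-- The target morphism `Π^L_H = id ∗ λ_H`. -/
def piL : H ⟶ H := conv (mul H) (comul H) (𝟙 H) (antipode H)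

/-- The source morphism `Π^R_H = λ_H ∗ id`. -/
def piR : H ⟶ H := conv (mul H) (comul H) (antipode H) (𝟙 H)

/-- `(M, φ, ρ)` is a right-right `H`-Hopf module. -/
structure IsHopfModule {M : C} (φ : M ⊗ H ⟶ M) (ρ : M ⟶ M ⊗ H) : Prop where
  coact_counit : ρ ≫ M ◁ counit H = (ρ_ M).inv
  coact_coassoc : ρ ≫ ρ ▷ H ≫ (α_ M H H).hom = ρ ≫ M ◁ comul H
  act_unit : M ◁ unit H ≫ φ = (ρ_ M).hom
  act_coact : φ ≫ ρ = (ρ ⊗ₘ comul H) ≫ tensorμ M H H H ≫ (φ ⊗ₘ mul H)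
  act_antipode : M ◁ comul H ⊗≫ (φ ⊗ₘ antipode H) ≫ φ = M ◁ piL H ≫ φ
  antipode_act : M ◁ comul H ⊗≫ (M ◁ antipode H) ▷ H ≫ φ ▷ H ≫ φ = M ◁ piR H ≫ φ
  piL_act : M ◁ comul H ⊗≫ (M ◁ piL H) ▷ H ≫ φ ▷ H ≫ φ = φ

/-- Right-right `H`-Hopf modules. -/
structure HopfModule where
  X : C
  act : X ⊗ H ⟶ X
  coact : X ⟶ X ⊗ H
  isHopfModule : IsHopfModule H act coact

end

/-- A splitting of an endomorphism `f` through an object `obj` (the image of `f`). -/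
structure Splitting {C : Type u} [Category.{v} C] {X : C} (f : X ⟶ X) where
  obj : C
  i : obj ⟶ X
  p : X ⟶ obj
  i_p : i ≫ p = 𝟙 obj
  p_i : p ≫ i = f

namespace HopfModule

variable {C : Type u} [Category.{v} C] [MonoidalCategory C] [BraidedCategory C]
variable {H : C} [WeakHopfQuasigroup H] (M : HopfModule H)

/-- `q_M = φ_M ∘ (M ⊗ λ_H) ∘ ρ_M`. The object of a splitting of `q_M` is the object of
coinvariants `M^{co H}`. -/
def q : M.X ⟶ M.X := M.coact ≫ M.X ◁ antipode H ≫ M.act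

/-- `ω_M = φ_M ∘ (i_M ⊗ H) : M^{co H} ⊗ H ⟶ M`. -/
def omega (s : Splitting M.q) : s.obj ⊗ H ⟶ M.X := s.i ▷ H ≫ M.act

/-- `ω'_M = (p_M ⊗ H) ∘ ρ_M : M ⟶ M^{co H} ⊗ H`. -/
def omega' (s : Splitting M.q) : M.X ⟶ s.obj ⊗ H := M.coact ≫ s.p ▷ H

/-- `∇_M = (p_M ⊗ H) ∘ ρ_M ∘ φ_M ∘ (i_M ⊗ H)`. The object of a splitting of `∇_M` is
`M^{co H} × H`. -/
def nabla (s : Splitting M.q) : s.obj ⊗ H ⟶ s.obj ⊗ H :=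
  s.i ▷ H ≫ M.act ≫ M.coact ≫ s.p ▷ H

/-- The action `p ∘ (M^{co H} ⊗ μ_H) ∘ (i ⊗ H)` on `M^{co H} × H`. -/
def timesAct (s : Splitting M.q) (t : Splitting (M.nabla s)) : t.obj ⊗ H ⟶ t.obj :=
  t.i ▷ H ≫ (α_ s.obj H H).hom ≫ s.obj ◁ mul H ≫ t.p

/-- The coaction `(p ⊗ H) ∘ (M^{co H} ⊗ δ_H) ∘ i` on `M^{co H} × H`. -/
def timesCoact (s : Splitting M.q) (t : Splitting (M.nabla s)) : t.obj ⟶ t.obj ⊗ H :=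
  t.i ≫ s.obj ◁ comul H ≫ (α_ s.obj H H).inv ≫ t.p ▷ H

/-- `α_M = p ∘ ω'_M = p ∘ (p_M ⊗ H) ∘ ρ_M : M ⟶ M^{co H} × H`. -/
def alpha (s : Splitting M.q) (t : Splitting (M.nabla s)) : M.X ⟶ t.obj :=
  M.omega' s ≫ t.p

/-- `ω_M ∘ i : M^{co H} × H ⟶ M`, the inverse of `α_M`. -/
def alphaInv (s : Splitting M.q) (t : Splitting (M.nabla s)) : t.obj ⟶ M.X :=
  t.i ≫ M.omega s

open Classical in
/-- `φ_M^{α_M} = α_M⁻¹ ∘ φ_{M^{co H} × H} ∘ (α_M ⊗ H)`, the action of `M^{co H} × H` transported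
to `M` along `α_M`, for a chosen `M^{co H}` and a chosen `M^{co H} × H`. (The second branch is never
taken when idempotents split in `C`, since `q_M` and `∇_M` are idempotent.) -/
noncomputable def actAlpha : M.X ⊗ H ⟶ M.X :=
  if h : Nonempty (Σ s : Splitting M.q, Splitting (M.nabla s)) then
    M.alpha h.some.1 h.some.2 ▷ H ≫ M.timesAct h.some.1 h.some.2 ≫ M.alphaInv h.some.1 h.some.2
  else M.act

/-- Morphisms of right-right `H`-Hopf modules: morphisms of right `H`-comodules that are
`H`-quasilinear. -/
@[ext]
structure Hom (M N : HopfModule H) where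
  hom : M.X ⟶ N.X
  comodule : hom ≫ N.coact = M.coact ≫ hom ▷ H
  quasilinear : hom ▷ H ≫ N.actAlpha = M.actAlpha ≫ hom

/-- The category of right-right `H`-Hopf modules. -/
noncomputable instance : Category (HopfModule H) where
  Hom M N := Hom M N
  id M := ⟨𝟙 M.X, by simp, by simp⟩
  comp f g := ⟨f.hom ≫ g.hom,
    by rw [Category.assoc, g.comodule, ← Category.assoc, f.comodule, Category.assoc,
      comp_whiskerRight],
    by rw [comp_whiskerRight, Category.assoc, g.quasilinear, ← Category.assoc, f.quasilinear,
      Category.assoc]⟩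
  id_comp f := Hom.ext (Category.id_comp f.hom)
  comp_id f := Hom.ext (Category.comp_id f.hom)
  assoc f g h := Hom.ext (Category.assoc f.hom g.hom h.hom)

end HopfModule

end WeakHopf

namespace WeakHopf

/-! In Sweedler notation, write `q(m) = m₀ λ(m₁)`. The identity `q(m₀) m₁ = m` (`coact_q_act_word`)
says that `ω'` followed by `ω` is the identity of `M`. Hence `∇`, which is `ω` followed by `ω'`, is
idempotent, and `M` is itself an image of `∇`. This makes `α` an isomorphism of objects with the
stated inverse. Idempotency of `q` is the case `h = 1` of `q(n h) = n Π^L(h)` for `n` in the image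
of `q` (`q_act_q_word`), which rests on `ρ(n h) = n h₁ ⊗ h₂` (`q_act_coact_word`).

The map `α` is colinear, but without associativity it need not carry the action of `M` to that of
`M^{co H} × H`. Transporting the latter back gives `m · h = q(m₀)(m₁ h)`, which is `qAct` and
involves no splitting. Since `(n h) · k = n (h k)` on the image of `q`, iterated `qAct` takes place
inside the factor `H`. So `qAct` inherits the Hopf module axioms from `H`, and `M^{co H} × H`
receives them through `α`.

For quasilinearity, `actAlpha` is `qAct` for every Hopf module, and replacing the action by `qAct`
changes neither `q` nor `qAct`. Thus `α`, strictly linear for `qAct`, also intertwines the two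
quasi-actions. -/

theorem comp_comp_congr {C : Type u} [Category.{v} C] {X Y Y' Z W : C} {f : X ⟶ Y} {g : Y ⟶ Z}
    {f' : X ⟶ Y'} {g' : Y' ⟶ Z} (e : f ≫ g = f' ≫ g') (k : Z ⟶ W) : f ≫ g ≫ k = f' ≫ g' ≫ k := by
  rw [reassoc_of% e]

/-! ### Calculus of right-nested tensor words -/

section Words

variable {C : Type u} [Category.{v} C] [MonoidalCategory C]

/-- `f : A ⟶ B` applied to the first letter of a right-nested tensor product. -/
def onHead {A B : C} (f : A ⟶ B) (Z : C) : A ⊗ Z ⟶ B ⊗ Z := f ▷ Z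

/-- `f : A ⊗ B ⟶ D` applied to the first two letters of a right-nested tensor product. -/
def merge {A B D : C} (f : A ⊗ B ⟶ D) (Z : C) : A ⊗ B ⊗ Z ⟶ D ⊗ Z := (α_ A B Z).inv ≫ f ▷ Z

/-- `f : D ⟶ A ⊗ B` applied to the first letter of a right-nested tensor product. -/
def split {A B D : C} (f : D ⟶ A ⊗ B) (Z : C) : D ⊗ Z ⟶ A ⊗ B ⊗ Z := f ▷ Z ≫ (α_ A B Z).hom

/-- `f : 𝟙_ C ⟶ A` inserting a new first letter. -/
def create {A : C} (f : 𝟙_ C ⟶ A) (Z : C) : Z ⟶ A ⊗ Z := (λ_ Z).inv ≫ f ▷ Z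

/-- `f : A ⟶ 𝟙_ C` deleting the first letter. -/
def discard {A : C} (f : A ⟶ 𝟙_ C) (Z : C) : A ⊗ Z ⟶ Z := f ▷ Z ≫ (λ_ Z).hom

/-- `f : A ⊗ B ⟶ 𝟙_ C` deleting the first two letters. -/
def annihilate {A B : C} (f : A ⊗ B ⟶ 𝟙_ C) (Z : C) : A ⊗ B ⊗ Z ⟶ Z :=
  merge f Z ≫ (λ_ Z).hom

section Naturality

variable {A B D Z Z' : C} (h : Z ⟶ Z')

theorem onHead_naturality (f : A ⟶ B) : onHead f Z ≫ B ◁ h = A ◁ h ≫ onHead f Z' := by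
  simp [onHead, whisker_exchange]

theorem merge_naturality (f : A ⊗ B ⟶ D) :
    merge f Z ≫ D ◁ h = A ◁ B ◁ h ≫ merge f Z' := by
  simp [merge, ← whisker_exchange]

theorem split_naturality (f : D ⟶ A ⊗ B) :
    split f Z ≫ A ◁ B ◁ h = D ◁ h ≫ split f Z' := by
  simp [split, whisker_exchange_assoc]

theorem create_naturality (f : 𝟙_ C ⟶ A) : create f Z ≫ A ◁ h = h ≫ create f Z' := by
  simp [create, ← whisker_exchange]

theorem discard_naturality (f : A ⟶ 𝟙_ C) : discard f Z ≫ h = A ◁ h ≫ discard f Z' := by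
  simp [discard, whisker_exchange_assoc]

theorem annihilate_naturality (f : A ⊗ B ⟶ 𝟙_ C) :
    annihilate f Z ≫ h = A ◁ B ◁ h ≫ annihilate f Z' := by
  simp [annihilate, ← reassoc_of% merge_naturality h f]

end Naturality

/-- Interchange moves what happens further to the right to the front; iterated left whiskerings are
kept collected. -/
theorem interchange :
    (∀ {X Y Z W : C} (f : X ⟶ Y) (g : Y ⟶ Z) (h : Z ⟶ W), (f ≫ g) ≫ h = f ≫ g ≫ h) ∧
    (∀ {X Y : C} (f : X ⟶ Y), 𝟙 X ≫ f = f) ∧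
    (∀ {X Y : C} (f : X ⟶ Y), f ≫ 𝟙 Y = f) ∧
    (∀ (X Y : C), X ◁ 𝟙 Y = 𝟙 (X ⊗ Y)) ∧
    (∀ (W : C) {X Y Z : C} (f : X ⟶ Y) (g : Y ⟶ Z), W ◁ f ≫ W ◁ g = W ◁ (f ≫ g)) ∧
    (∀ (W : C) {X Y Z V : C} (f : X ⟶ Y) (g : Y ⟶ Z) (k : W ⊗ Z ⟶ V),
      W ◁ f ≫ W ◁ g ≫ k = W ◁ (f ≫ g) ≫ k) ∧
    (∀ {A B Z Z' : C} (f : A ⟶ B) (h : Z ⟶ Z'),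
      onHead f Z ≫ B ◁ h = A ◁ h ≫ onHead f Z') ∧
    (∀ {A B Z Z' V : C} (f : A ⟶ B) (h : Z ⟶ Z') (k : B ⊗ Z' ⟶ V),
      onHead f Z ≫ B ◁ h ≫ k = A ◁ h ≫ onHead f Z' ≫ k) ∧
    (∀ {A B D Z Z' : C} (f : A ⊗ B ⟶ D) (h : Z ⟶ Z'),
      merge f Z ≫ D ◁ h = A ◁ B ◁ h ≫ merge f Z') ∧
    (∀ {A B D Z Z' V : C} (f : A ⊗ B ⟶ D) (h : Z ⟶ Z') (k : D ⊗ Z' ⟶ V),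
      merge f Z ≫ D ◁ h ≫ k = A ◁ B ◁ h ≫ merge f Z' ≫ k) ∧
    (∀ {A B D Z Z' : C} (f : D ⟶ A ⊗ B) (h : Z ⟶ Z'),
      split f Z ≫ A ◁ B ◁ h = D ◁ h ≫ split f Z') ∧
    (∀ {A B D Z Z' V : C} (f : D ⟶ A ⊗ B) (h : Z ⟶ Z') (k : A ⊗ B ⊗ Z' ⟶ V),
      split f Z ≫ A ◁ B ◁ h ≫ k = D ◁ h ≫ split f Z' ≫ k) ∧
    (∀ {A B D Z Z' U : C} (f : D ⟶ A ⊗ B) (h : Z ⟶ Z') (g : B ⊗ Z' ⟶ U),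
      split f Z ≫ A ◁ (B ◁ h ≫ g) = D ◁ h ≫ split f Z' ≫ A ◁ g) ∧
    (∀ {A B D Z Z' U V : C} (f : D ⟶ A ⊗ B) (h : Z ⟶ Z') (g : B ⊗ Z' ⟶ U) (k : A ⊗ U ⟶ V),
      split f Z ≫ A ◁ (B ◁ h ≫ g) ≫ k = D ◁ h ≫ split f Z' ≫ A ◁ g ≫ k) ∧
    (∀ {A Z Z' : C} (f : 𝟙_ C ⟶ A) (h : Z ⟶ Z'),
      create f Z ≫ A ◁ h = h ≫ create f Z') ∧
    (∀ {A Z Z' V : C} (f : 𝟙_ C ⟶ A) (h : Z ⟶ Z') (k : A ⊗ Z' ⟶ V),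
      create f Z ≫ A ◁ h ≫ k = h ≫ create f Z' ≫ k) ∧
    (∀ {A Z Z' : C} (f : A ⟶ 𝟙_ C) (h : Z ⟶ Z'),
      discard f Z ≫ h = A ◁ h ≫ discard f Z') ∧
    (∀ {A B Z Z' : C} (f : A ⊗ B ⟶ 𝟙_ C) (h : Z ⟶ Z'),
      annihilate f Z ≫ h = A ◁ B ◁ h ≫ annihilate f Z') := by
  refine ⟨fun _ _ _ => Category.assoc _ _ _, fun _ => Category.id_comp _,
    fun _ => Category.comp_id _, fun _ _ => whiskerLeft_id _ _,
    fun _ _ _ _ _ _ => (whiskerLeft_comp _ _ _).symm,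
    fun _ _ _ _ _ _ _ _ => (whiskerLeft_comp_assoc _ _ _ _).symm,
    fun f h => onHead_naturality h f, fun f h k => comp_comp_congr (onHead_naturality h f) k,
    fun f h => merge_naturality h f, fun f h k => comp_comp_congr (merge_naturality h f) k,
    fun f h => split_naturality h f, fun f h k => comp_comp_congr (split_naturality h f) k,
    fun f h g => ?_, fun f h g k => ?_,
    fun f h => create_naturality h f, fun f h k => comp_comp_congr (create_naturality h f) k,
    fun f h => discard_naturality h f, fun f h => annihilate_naturality h f⟩
  · rw [whiskerLeft_comp, reassoc_of% split_naturality h f]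
  · rw [whiskerLeft_comp_assoc, reassoc_of% split_naturality h f]

/-- The unit object as `Z` recovers the original equation. This passes between axioms and their word
forms, where an arbitrary tail `Z` lets them be applied inside longer words. -/
theorem eq_iff_forall_whiskerRight {A B : C} {f g : A ⟶ B} :
    f = g ↔ ∀ Z : C, f ▷ Z = g ▷ Z :=
  ⟨fun h _ => by rw [h], fun h => by simpa using h (𝟙_ C)⟩

theorem merge_injective {A B D : C} {f g : A ⊗ B ⟶ D}
    (h : merge f (𝟙_ C) = merge g (𝟙_ C)) : f = g := by
  simpa [merge] using h

end Words

/-! ### Braidings of adjacent letters -/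

section Braiding

open BraidedCategory

variable {C : Type u} [Category.{v} C] [MonoidalCategory C] [BraidedCategory C]

/-- The braiding of the first two letters. -/
def cross (X Y Z : C) : X ⊗ Y ⊗ Z ⟶ Y ⊗ X ⊗ Z :=
  (α_ X Y Z).inv ≫ (β_ X Y).hom ▷ Z ≫ (α_ Y X Z).hom

/-- The inverse braiding of the first two letters. -/
def crossInv (X Y Z : C) : X ⊗ Y ⊗ Z ⟶ Y ⊗ X ⊗ Z :=
  (α_ X Y Z).inv ≫ (β_ Y X).inv ▷ Z ≫ (α_ Y X Z).hom

theorem cross_crossInv (X Y Z : C) : cross X Y Z ≫ crossInv Y X Z = 𝟙 _ := by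
  simp [cross, crossInv]

theorem crossInv_cross (X Y Z : C) : crossInv X Y Z ≫ cross Y X Z = 𝟙 _ := by
  simp [cross, crossInv]

theorem cross_naturality (X Y : C) {Z Z' : C} (h : Z ⟶ Z') :
    cross X Y Z ≫ Y ◁ X ◁ h = X ◁ Y ◁ h ≫ cross X Y Z' := by
  simp only [cross, Category.assoc]
  rw [← associator_naturality_right, ← whisker_exchange_assoc,
    ← associator_inv_naturality_right_assoc]

theorem crossInv_naturality (X Y : C) {Z Z' : C} (h : Z ⟶ Z') :
    crossInv X Y Z ≫ Y ◁ X ◁ h = X ◁ Y ◁ h ≫ crossInv X Y Z' := by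
  simp only [crossInv, Category.assoc]
  rw [← associator_naturality_right, ← whisker_exchange_assoc,
    ← associator_inv_naturality_right_assoc]

/-- Companion to `interchange` as a rewriting system. The nested variants are needed because
consecutive left whiskerings are kept collected under a single one. -/
theorem interchange_cross :
    (∀ (X Y : C) {Z Z' : C} (h : Z ⟶ Z'),
      cross X Y Z ≫ Y ◁ X ◁ h = X ◁ Y ◁ h ≫ cross X Y Z') ∧
    (∀ (X Y : C) {Z Z' V : C} (h : Z ⟶ Z') (k : Y ⊗ X ⊗ Z' ⟶ V),
      cross X Y Z ≫ Y ◁ X ◁ h ≫ k = X ◁ Y ◁ h ≫ cross X Y Z' ≫ k) ∧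
    (∀ (X Y : C) {Z Z' U : C} (h : Z ⟶ Z') (g : X ⊗ Z' ⟶ U),
      cross X Y Z ≫ Y ◁ (X ◁ h ≫ g) = X ◁ Y ◁ h ≫ cross X Y Z' ≫ Y ◁ g) ∧
    (∀ (X Y : C) {Z Z' U V : C} (h : Z ⟶ Z') (g : X ⊗ Z' ⟶ U) (k : Y ⊗ U ⟶ V),
      cross X Y Z ≫ Y ◁ (X ◁ h ≫ g) ≫ k = X ◁ Y ◁ h ≫ cross X Y Z' ≫ Y ◁ g ≫ k) ∧
    (∀ (X Y : C) {Z Z' : C} (h : Z ⟶ Z'),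
      crossInv X Y Z ≫ Y ◁ X ◁ h = X ◁ Y ◁ h ≫ crossInv X Y Z') ∧
    (∀ (X Y : C) {Z Z' V : C} (h : Z ⟶ Z') (k : Y ⊗ X ⊗ Z' ⟶ V),
      crossInv X Y Z ≫ Y ◁ X ◁ h ≫ k = X ◁ Y ◁ h ≫ crossInv X Y Z' ≫ k) ∧
    (∀ (X Y : C) {Z Z' U : C} (h : Z ⟶ Z') (g : X ⊗ Z' ⟶ U),
      crossInv X Y Z ≫ Y ◁ (X ◁ h ≫ g) = X ◁ Y ◁ h ≫ crossInv X Y Z' ≫ Y ◁ g) ∧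
    (∀ (X Y : C) {Z Z' U V : C} (h : Z ⟶ Z') (g : X ⊗ Z' ⟶ U) (k : Y ⊗ U ⟶ V),
      crossInv X Y Z ≫ Y ◁ (X ◁ h ≫ g) ≫ k =
        X ◁ Y ◁ h ≫ crossInv X Y Z' ≫ Y ◁ g ≫ k) := by
  refine ⟨cross_naturality, fun X Y _ _ _ h k => comp_comp_congr (cross_naturality X Y h) k,
    fun X Y _ _ _ h g => ?_, fun X Y _ _ _ _ h g k => ?_,
    crossInv_naturality, fun X Y _ _ _ h k => comp_comp_congr (crossInv_naturality X Y h) k,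
    fun X Y _ _ _ h g => ?_, fun X Y _ _ _ _ h g k => ?_⟩
  · rw [whiskerLeft_comp, reassoc_of% cross_naturality X Y h]
  · rw [whiskerLeft_comp_assoc, reassoc_of% cross_naturality X Y h]
  · rw [whiskerLeft_comp, reassoc_of% crossInv_naturality X Y h]
  · rw [whiskerLeft_comp_assoc, reassoc_of% crossInv_naturality X Y h]

section

variable {A B D : C} (Y Z : C)

theorem cross_onHead (f : A ⟶ B) :
    cross Y A Z ≫ onHead f (Y ⊗ Z) = Y ◁ onHead f Z ≫ cross Y B Z := by
  simp only [cross, onHead]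
  rw [associator_inv_naturality_middle_assoc, ← comp_whiskerRight_assoc,
    braiding_naturality_right]
  simp

theorem onHead_cross (f : A ⟶ B) :
    onHead f (Y ⊗ Z) ≫ cross B Y Z = cross A Y Z ≫ Y ◁ onHead f Z := by
  simp only [cross, onHead]
  rw [associator_inv_naturality_left_assoc, ← comp_whiskerRight_assoc,
    braiding_naturality_left]
  simp

theorem merge_cross (f : A ⊗ B ⟶ D) :
    merge f (Y ⊗ Z) ≫ cross D Y Z = A ◁ cross B Y Z ≫ cross A Y (B ⊗ Z) ≫ Y ◁ merge f Z := by
  simp only [cross, merge, Category.assoc]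
  rw [associator_inv_naturality_left_assoc, ← comp_whiskerRight_assoc,
    braiding_naturality_left, braiding_tensor_left_hom]
  monoidal

theorem cross_merge (f : A ⊗ B ⟶ D) :
    Y ◁ merge f Z ≫ cross Y D Z = cross Y A (B ⊗ Z) ≫ A ◁ cross Y B Z ≫ merge f (Y ⊗ Z) := by
  simp only [cross, merge, Category.assoc, whiskerLeft_comp]
  rw [associator_inv_naturality_middle_assoc, ← comp_whiskerRight_assoc,
    braiding_naturality_right, braiding_tensor_right_hom]
  monoidal

theorem split_cross (f : D ⟶ A ⊗ B) :
    split f (Y ⊗ Z) ≫ A ◁ cross B Y Z ≫ cross A Y (B ⊗ Z) = cross D Y Z ≫ Y ◁ split f Z := by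
  simp only [cross, split, Category.assoc, whiskerLeft_comp]
  rw [← associator_naturality_middle_assoc, ← comp_whiskerRight_assoc,
    ← braiding_naturality_left, braiding_tensor_left_hom]
  monoidal

theorem cross_split (f : D ⟶ A ⊗ B) :
    Y ◁ split f Z ≫ cross Y A (B ⊗ Z) ≫ A ◁ cross Y B Z = cross Y D Z ≫ split f (Y ⊗ Z) := by
  simp only [cross, split, Category.assoc, whiskerLeft_comp]
  rw [← associator_naturality_left_assoc, ← comp_whiskerRight_assoc,
    ← braiding_naturality_right, braiding_tensor_right_hom]
  monoidal

theorem create_cross (f : 𝟙_ C ⟶ A) :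
    create f (Y ⊗ Z) ≫ cross A Y Z = Y ◁ create f Z := by
  simp only [cross, create, Category.assoc, whiskerLeft_comp]
  rw [associator_inv_naturality_left_assoc, ← comp_whiskerRight_assoc,
    braiding_naturality_left, braiding_tensorUnit_left]
  monoidal

theorem cross_discard (f : A ⟶ 𝟙_ C) :
    cross Y A Z ≫ discard f (Y ⊗ Z) = Y ◁ discard f Z := by
  simp only [cross, discard, Category.assoc, whiskerLeft_comp]
  rw [← associator_naturality_left_assoc, ← comp_whiskerRight_assoc,
    ← braiding_naturality_right, braiding_tensorUnit_right]
  monoidal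

theorem cross_annihilate (f : A ⊗ B ⟶ 𝟙_ C) :
    cross Y A (B ⊗ Z) ≫ A ◁ cross Y B Z ≫ annihilate f (Y ⊗ Z) = Y ◁ annihilate f Z := by
  -- Annihilation is a merge into the letter `𝟙_ C`, which is then discarded, so the two earlier
  -- rules apply.
  have h (W : C) : annihilate f W = merge f W ≫ discard (𝟙 _) W := by
    simp [annihilate, discard]
  simp only [h, whiskerLeft_comp]
  rw [← cross_discard, reassoc_of% cross_merge]

theorem crossInv_create (f : 𝟙_ C ⟶ A) :
    Y ◁ create f Z ≫ crossInv Y A Z = create f (Y ⊗ Z) := by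
  rw [← create_cross, Category.assoc, cross_crossInv, Category.comp_id]

theorem crossInv_split (f : D ⟶ A ⊗ B) :
    crossInv Y D Z ≫ split f (Y ⊗ Z) =
      Y ◁ split f Z ≫ crossInv Y A (B ⊗ Z) ≫ A ◁ crossInv Y B Z := by
  calc
    _ = crossInv Y D Z ≫ (split f (Y ⊗ Z) ≫ A ◁ cross B Y Z ≫ cross A Y (B ⊗ Z)) ≫
        crossInv Y A (B ⊗ Z) ≫ A ◁ crossInv Y B Z := by
      simp only [Category.assoc, reassoc_of% cross_crossInv, ← whiskerLeft_comp, cross_crossInv,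
        whiskerLeft_id, Category.comp_id]
    _ = _ := by rw [split_cross]; simp only [Category.assoc, reassoc_of% crossInv_cross]

theorem crossInv_annihilate (f : A ⊗ B ⟶ 𝟙_ C) :
    crossInv A Y (B ⊗ Z) ≫ Y ◁ annihilate f Z = A ◁ cross Y B Z ≫ annihilate f (Y ⊗ Z) := by
  rw [← cross_annihilate, reassoc_of% crossInv_cross]

theorem merge_crossInv (f : A ⊗ B ⟶ D) :
    merge f (Y ⊗ Z) ≫ crossInv D Y Z =
      A ◁ crossInv B Y Z ≫ crossInv A Y (B ⊗ Z) ≫ Y ◁ merge f Z := by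
  calc
    _ = A ◁ crossInv B Y Z ≫ crossInv A Y (B ⊗ Z) ≫
        (cross Y A (B ⊗ Z) ≫ A ◁ cross Y B Z ≫ merge f (Y ⊗ Z)) ≫ crossInv D Y Z := by
      simp only [Category.assoc, reassoc_of% crossInv_cross, ← whiskerLeft_comp_assoc,
        crossInv_cross, whiskerLeft_id, Category.id_comp]
    _ = _ := by
      rw [← cross_merge]; simp only [Category.assoc, cross_crossInv, Category.comp_id]

/-- A mixed Yang–Baxter relation. Factoring the inverse braiding through `B ⊗ A` treated as a single
letter reduces it to naturality of the braiding with `Y`. -/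
theorem cross_crossInv_cross (A B : C) :
    cross Y A (B ⊗ Z) ≫ A ◁ cross Y B Z ≫ crossInv A B (Y ⊗ Z) =
      Y ◁ crossInv A B Z ≫ cross Y B (A ⊗ Z) ≫ B ◁ cross Y A Z := by
  have h (W : C) : crossInv A B W = merge (β_ B A).inv W ≫ split (𝟙 (B ⊗ A)) W := by
    simp [crossInv, merge, split]
  rw [h, h, whiskerLeft_comp, Category.assoc, cross_split, reassoc_of% cross_merge]

end

end Braiding

/-! ### Weak Hopf quasigroups: axioms in word form and properties of `Π^L` -/

section WeakHopfQuasigroup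

variable {C : Type u} [Category.{v} C] [MonoidalCategory C] [BraidedCategory C]
variable (H : C) [WeakHopfQuasigroup H]

local notation "𝗆" => merge (mul H)
local notation "𝖽" => split (comul H)
local notation "𝗎" => create (unit H)
local notation "𝖾" => discard (counit H)
local notation "𝖾𝗆" => annihilate (mul H ≫ counit H)
local notation "𝗌" => onHead (antipode H)
local notation "𝗉" => onHead (piL H)
local notation "𝗋" => onHead (piR H)
local notation "𝖼" => cross H H
local notation "𝖼ᵢ" => crossInv H H

section Axioms

variable (Z : C)

theorem unit_mul_word : 𝗎 (H ⊗ Z) ≫ 𝗆 Z = 𝟙 _ := by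
  calc _ = 𝟙 _ ⊗≫ (unit H ▷ H ≫ mul H) ▷ Z := by simp only [create, merge]; monoidal
    _ = _ := by rw [UnitalMagmaObj.one_mul]; monoidal

theorem mul_unit_word : H ◁ 𝗎 Z ≫ 𝗆 Z = 𝟙 _ := by
  calc _ = 𝟙 _ ⊗≫ (H ◁ unit H ≫ mul H) ▷ Z := by simp only [create, merge]; monoidal
    _ = _ := by rw [UnitalMagmaObj.mul_one]; monoidal

theorem comul_counit_left_word : 𝖽 Z ≫ 𝖾 (H ⊗ Z) = 𝟙 _ := by
  calc _ = (comul H ≫ counit H ▷ H) ▷ Z ⊗≫ 𝟙 _ := by simp only [split, discard]; monoidal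
    _ = _ := by rw [ComonObj.counit_comul]; monoidal

theorem comul_assoc_word : 𝖽 Z ≫ 𝖽 (H ⊗ Z) = 𝖽 Z ≫ H ◁ 𝖽 Z := by
  symm
  calc _ = (comul H ≫ H ◁ comul H) ▷ Z ⊗≫ 𝟙 _ := by simp only [split]; monoidal
    _ = _ := by rw [ComonObj.comul_assoc]; simp only [split]; monoidal

theorem mul_counit_word : 𝗆 Z ≫ 𝖾 Z = 𝖾𝗆 Z := by
  simp [merge, discard, annihilate]

theorem mul_comul_word :
    𝗆 Z ≫ 𝖽 Z = H ◁ 𝖽 Z ≫ 𝖽 _ ≫ H ◁ 𝖼 _ ≫ H ◁ H ◁ 𝗆 Z ≫ 𝗆 _ := by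
  calc _ = 𝟙 _ ⊗≫ (mul H ≫ comul H) ▷ Z ⊗≫ 𝟙 _ := by simp only [split, merge]; monoidal
    _ = _ := by
      rw [WeakHopfQuasigroup.mul_comul]
      simp only [split, merge, cross, MonoidalCategory.tensorHom_def', tensorμ]
      monoidal

theorem counit_assoc_word : 𝗆 _ ≫ 𝖾𝗆 Z = H ◁ 𝗆 Z ≫ 𝖾𝗆 Z := by
  calc _ = 𝟙 _ ⊗≫ (mul H ▷ H ≫ mul H ≫ counit H) ▷ Z ⊗≫ 𝟙 _ := by
        simp only [annihilate, merge]; monoidal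
    _ = _ := by
      rw [WeakHopfQuasigroup.counit_assoc]
      simp only [annihilate, merge]; monoidal

theorem counit_weak_word : 𝗆 _ ≫ 𝖾𝗆 Z = H ◁ 𝖽 _ ≫ 𝖾𝗆 _ ≫ 𝖾𝗆 Z := by
  calc _ = 𝟙 _ ⊗≫ (mul H ▷ H ≫ mul H ≫ counit H) ▷ Z ⊗≫ 𝟙 _ := by
        simp only [annihilate, merge]; monoidal
    _ = _ := by
      rw [WeakHopfQuasigroup.counit_weak]
      simp only [annihilate, merge, split, MonoidalCategory.tensorHom_def]; monoidal

theorem counit_weak_braided_word : 𝗆 _ ≫ 𝖾𝗆 Z = H ◁ 𝖽 _ ≫ H ◁ 𝖼ᵢ _ ≫ 𝖾𝗆 _ ≫ 𝖾𝗆 Z := by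
  calc _ = 𝟙 _ ⊗≫ (mul H ▷ H ≫ mul H ≫ counit H) ▷ Z ⊗≫ 𝟙 _ := by
        simp only [annihilate, merge]; monoidal
    _ = _ := by
      rw [WeakHopfQuasigroup.counit_weak_braided]
      simp only [annihilate, merge, split, crossInv, MonoidalCategory.tensorHom_def]; monoidal

theorem unit_weak_word :
    𝗎 Z ≫ 𝖽 _ ≫ H ◁ 𝖽 _ = 𝗎 Z ≫ 𝖽 Z ≫ H ◁ H ◁ 𝗎 Z ≫ H ◁ H ◁ 𝖽 Z ≫ H ◁ 𝗆 _ := by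
  rw [← comul_assoc_word]
  calc _ = 𝟙 _ ⊗≫ (unit H ≫ comul H ≫ comul H ▷ H) ▷ Z ⊗≫ 𝟙 _ := by
        simp only [create, split]; monoidal
    _ = _ := by
      rw [WeakHopfQuasigroup.unit_weak]
      simp only [create, merge, split, MonoidalCategory.tensorHom_def]; monoidal

theorem unit_weak_braided_word :
    𝗎 Z ≫ 𝖽 _ ≫ H ◁ 𝖽 _ =
      𝗎 Z ≫ 𝖽 Z ≫ H ◁ H ◁ 𝗎 Z ≫ H ◁ H ◁ 𝖽 Z ≫ H ◁ 𝖼ᵢ _ ≫ H ◁ 𝗆 _ := by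
  rw [← comul_assoc_word]
  calc _ = 𝟙 _ ⊗≫ (unit H ≫ comul H ≫ comul H ▷ H) ▷ Z ⊗≫ 𝟙 _ := by
        simp only [create, split]; monoidal
    _ = _ := by
      rw [WeakHopfQuasigroup.unit_weak_braided]
      simp only [create, merge, split, crossInv, MonoidalCategory.tensorHom_def]; monoidal

theorem piL_word : 𝗉 Z = 𝖽 Z ≫ H ◁ 𝗌 Z ≫ 𝗆 Z := by
  simp only [piL, conv, onHead, split, merge]; monoidal

theorem piL_eq_word : 𝗉 Z = 𝗎 _ ≫ 𝖽 _ ≫ H ◁ 𝖼 _ ≫ 𝖾𝗆 _ := by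
  rw [piL, WeakHopfQuasigroup.convL_eq]
  simp only [create, split, cross, onHead, annihilate, merge]; monoidal

theorem piR_eq_word : 𝗋 Z = H ◁ 𝗎 _ ≫ H ◁ 𝖽 _ ≫ 𝖼 _ ≫ H ◁ 𝖾𝗆 _ := by
  rw [piR, WeakHopfQuasigroup.convR_eq]
  simp only [create, split, cross, onHead, annihilate, merge]; monoidal

theorem mul_antipode_right_word : H ◁ 𝖽 Z ≫ 𝗆 _ ≫ H ◁ 𝗌 Z ≫ 𝗆 Z = H ◁ 𝗉 Z ≫ 𝗆 Z := by
  symm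
  calc _ = 𝟙 _ ⊗≫ (H ◁ conv (mul H) (comul H) (𝟙 H) (antipode H) ≫ mul H) ▷ Z := by
        simp only [piL, onHead, merge]; monoidal
    _ = _ := by
      rw [← WeakHopfQuasigroup.mul_antipode_right]
      simp only [split, merge, onHead, MonoidalCategory.tensorHom_def]; monoidal

theorem antipode_mul_right_word : H ◁ 𝖽 Z ≫ H ◁ 𝗌 _ ≫ 𝗆 _ ≫ 𝗆 Z = H ◁ 𝗋 Z ≫ 𝗆 Z := by
  symm
  calc _ = 𝟙 _ ⊗≫ (H ◁ conv (mul H) (comul H) (antipode H) (𝟙 H) ≫ mul H) ▷ Z := by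
        simp only [piR, onHead, merge]; monoidal
    _ = _ := by
      rw [← WeakHopfQuasigroup.antipode_mul_right]
      simp only [split, merge, onHead]; monoidal

end Axioms

section Lemmas

variable (Z : C)

/-- Multiplicativity of the coproduct and the counit axioms give `ε(x (h₁ k₁)) = ε(x h₁) ε(h₂ k₁)`.
The remaining legs then reassemble into the coproduct of `h₂ k` with one leg killed by `ε`. -/
theorem counit_mul_comul_word :
    H ◁ 𝗆 _ ≫ H ◁ 𝖽 _ ≫ 𝖾𝗆 _ = H ◁ 𝖽 _ ≫ 𝖾𝗆 _ ≫ 𝗆 Z := by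
  calc
    _ = H ◁ (𝗆 _ ≫ 𝖽 _) ≫ 𝖾𝗆 _ := by simp only [interchange]
    _ = H ◁ (H ◁ 𝖽 _ ≫ 𝖽 _ ≫ H ◁ 𝖼 _ ≫ H ◁ H ◁ 𝗆 _) ≫ (H ◁ 𝗆 _ ≫ 𝖾𝗆 _) := by
      rw [mul_comul_word]; simp only [interchange]
    _ = H ◁ (H ◁ 𝖽 _ ≫ (𝖽 _ ≫ 𝖽 _) ≫ H ◁ H ◁ 𝖼 _ ≫ H ◁ H ◁ H ◁ 𝗆 _) ≫ 𝖾𝗆 _ ≫ 𝖾𝗆 _ := by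
      rw [← counit_assoc_word, counit_weak_word]; simp only [interchange]
    _ = H ◁ 𝖽 _ ≫ 𝖾𝗆 _ ≫ (H ◁ 𝖽 _ ≫ 𝖽 _ ≫ H ◁ 𝖼 _ ≫ H ◁ H ◁ 𝗆 _ ≫ 𝗆 _) ≫ 𝖾 _ := by
      rw [comul_assoc_word]; simp only [interchange, mul_counit_word]
    _ = H ◁ 𝖽 _ ≫ 𝖾𝗆 _ ≫ 𝗆 _ ≫ 𝖽 _ ≫ 𝖾 _ := by
      rw [← mul_comul_word, Category.assoc]
    _ = _ := by rw [comul_counit_left_word, Category.comp_id]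

theorem piL_eq_braidInv_word : 𝗉 Z = H ◁ 𝗎 _ ≫ H ◁ 𝖽 _ ≫ 𝖼ᵢ _ ≫ 𝖾𝗆 _ := by
  calc
    _ = (H ◁ 𝗎 _ ≫ 𝖼ᵢ _) ≫ 𝖽 _ ≫ H ◁ 𝖼 _ ≫ 𝖾𝗆 _ := by rw [piL_eq_word, crossInv_create]
    _ = H ◁ 𝗎 _ ≫ (𝖼ᵢ _ ≫ 𝖽 _) ≫ H ◁ 𝖼 _ ≫ 𝖾𝗆 _ := by simp only [interchange]
    _ = H ◁ 𝗎 _ ≫ H ◁ 𝖽 _ ≫ 𝖼ᵢ _ ≫ H ◁ (𝖼ᵢ _ ≫ 𝖼 _) ≫ 𝖾𝗆 _ := by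
      rw [crossInv_split]; simp only [interchange]
    _ = _ := by rw [crossInv_cross]; simp only [interchange]

/-- This is the braided unit axiom with `ε` applied to the middle leg. -/
theorem unit_piL_word : 𝗎 Z ≫ 𝖽 Z ≫ H ◁ 𝗉 Z = 𝗎 Z ≫ 𝖽 Z := by
  calc
    _ = (𝗎 Z ≫ 𝖽 Z ≫ H ◁ H ◁ 𝗎 Z ≫ H ◁ H ◁ 𝖽 Z ≫ H ◁ 𝖼ᵢ _ ≫ H ◁ 𝗆 _) ≫ H ◁ 𝖾 _ := by
      rw [piL_eq_braidInv_word]; simp only [interchange, mul_counit_word]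
    _ = 𝗎 Z ≫ 𝖽 _ ≫ H ◁ (𝖽 _ ≫ 𝖾 _) := by
      rw [← unit_weak_braided_word]; simp only [interchange]
    _ = _ := by rw [comul_counit_left_word]; simp only [interchange]

theorem unit_comp_piL_word : 𝗎 Z ≫ 𝗉 Z = 𝗎 Z := by
  calc
    _ = 𝗎 Z ≫ (𝖽 _ ≫ 𝖾 _) ≫ 𝗉 Z := by rw [comul_counit_left_word, Category.id_comp]
    _ = (𝗎 Z ≫ 𝖽 Z ≫ H ◁ 𝗉 Z) ≫ 𝖾 _ := by simp only [interchange]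
    _ = 𝗎 Z ≫ 𝖽 Z ≫ 𝖾 _ := by rw [unit_piL_word]; simp only [interchange]
    _ = _ := by rw [comul_counit_left_word, Category.comp_id]

theorem piL_comul_eq_word :
    𝗉 Z ≫ 𝖽 Z = 𝗎 _ ≫ 𝖽 _ ≫ H ◁ (𝖽 _ ≫ H ◁ 𝖼 _ ≫ 𝖼 _) ≫ 𝖾𝗆 _ := by
  calc
    _ = 𝗎 _ ≫ 𝖽 _ ≫ H ◁ (𝖼 _ ≫ H ◁ 𝖽 _) ≫ 𝖾𝗆 _ := by
      rw [piL_eq_word]; simp only [interchange]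
    _ = _ := by rw [← split_cross]

theorem unit_comul_piL_word : 𝗎 Z ≫ 𝖽 Z ≫ H ◁ (𝖽 Z ≫ H ◁ 𝗉 Z) = 𝗎 Z ≫ 𝖽 Z ≫ H ◁ 𝖽 Z := by
  calc
    _ = 𝗎 Z ≫ (𝖽 Z ≫ H ◁ 𝖽 Z) ≫ H ◁ H ◁ 𝗉 Z := by simp only [interchange]
    _ = (𝗎 Z ≫ 𝖽 Z ≫ H ◁ 𝗉 Z) ≫ 𝖽 _ := by
      rw [← comul_assoc_word]; simp only [interchange]
    _ = _ := by rw [unit_piL_word, Category.assoc, comul_assoc_word]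

/-- The second leg of the coproduct of `Π^L(y) = ε(1₁ y) 1₂` is the last leg of an iterated
coproduct of the unit, and `Π^L` fixes that leg. -/
theorem piL_comul_word : 𝗉 Z ≫ 𝖽 Z ≫ H ◁ 𝗉 Z = 𝗉 Z ≫ 𝖽 Z := by
  calc
    _ = (𝗉 Z ≫ 𝖽 Z) ≫ H ◁ 𝗉 Z := by rw [Category.assoc]
    _ = 𝗎 _ ≫ 𝖽 _ ≫ H ◁ (𝖽 _ ≫ H ◁ (𝖼 _ ≫ H ◁ 𝗉 _) ≫ 𝖼 _) ≫ 𝖾𝗆 _ := by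
      rw [piL_comul_eq_word]; simp only [interchange, interchange_cross]
    _ = (𝗎 _ ≫ 𝖽 _ ≫ H ◁ (𝖽 _ ≫ H ◁ 𝗉 _)) ≫ H ◁ (H ◁ 𝖼 _ ≫ 𝖼 _) ≫ 𝖾𝗆 _ := by
      rw [← onHead_cross]; simp only [interchange]
    _ = _ := by
      rw [unit_comul_piL_word, piL_comul_eq_word]; simp only [interchange]

theorem piL_idem_word : 𝗉 Z ≫ 𝗉 Z = 𝗉 Z := by
  calc
    _ = 𝗉 Z ≫ (𝖽 _ ≫ 𝖾 _) ≫ 𝗉 Z := by rw [comul_counit_left_word, Category.id_comp]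
    _ = (𝗉 Z ≫ 𝖽 _ ≫ H ◁ 𝗉 Z) ≫ 𝖾 _ := by simp only [interchange]
    _ = 𝗉 Z ≫ 𝖽 Z ≫ 𝖾 _ := by rw [piL_comul_word, Category.assoc]
    _ = _ := by rw [comul_counit_left_word, Category.comp_id]

/-- `x Π^L(y) = ε(x₁ y) x₂`. -/
theorem mul_piL_word : H ◁ 𝗉 Z ≫ 𝗆 Z = 𝖽 _ ≫ H ◁ 𝖼 _ ≫ 𝖾𝗆 _ := by
  symm
  calc
    -- Write `x` as `x 1`. The braided counit axiom turns `ε((x₁ 1₁) y) x₂ 1₂` into `ε(x₁ 1₂) ε(1₁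
    -- y) x₂ 1₃`, in which the coproduct of `Π^L(y)` appears.
    _ = H ◁ 𝗎 _ ≫ (𝗆 _ ≫ 𝖽 _) ≫ H ◁ 𝖼 _ ≫ 𝖾𝗆 _ := by
      simp only [Category.assoc, reassoc_of% mul_unit_word]
    _ = H ◁ (𝗎 _ ≫ 𝖽 _) ≫ 𝖽 _ ≫ H ◁ (𝖼 _ ≫ H ◁ (𝗆 _ ≫ 𝖼 _)) ≫ 𝗆 _ ≫ 𝖾𝗆 _ := by
      rw [mul_comul_word]; simp only [interchange]
    _ = H ◁ (𝗎 _ ≫ 𝖽 _) ≫ 𝖽 _ ≫ H ◁ ((𝖼 _ ≫ 𝖽 _) ≫ 𝖼ᵢ _ ≫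
        H ◁ H ◁ (H ◁ 𝖼 _ ≫ 𝖼 _ ≫ H ◁ 𝗆 _)) ≫ 𝖾𝗆 _ ≫ 𝖾𝗆 _ := by
      rw [merge_cross, counit_weak_braided_word]; simp only [interchange, interchange_cross]
    _ = H ◁ (𝗎 _ ≫ 𝖽 _ ≫ 𝖽 _) ≫ 𝖽 _ ≫ H ◁ ((𝖼 _ ≫ H ◁ 𝖼 _ ≫ 𝖼ᵢ _) ≫
        H ◁ H ◁ (H ◁ 𝖼 _ ≫ 𝖼 _ ≫ H ◁ 𝗆 _)) ≫ 𝖾𝗆 _ ≫ 𝖾𝗆 _ := by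
      rw [← cross_split]; simp only [interchange, interchange_cross]
    _ = H ◁ (𝗎 _ ≫ 𝖽 _ ≫ 𝖽 _) ≫ 𝖽 _ ≫ H ◁ (H ◁ 𝖼ᵢ _ ≫ 𝖼 _ ≫
        H ◁ (H ◁ H ◁ 𝖼 _ ≫ (𝖼 _ ≫ H ◁ 𝖼 _ ≫ 𝖾𝗆 _) ≫ 𝗆 _)) ≫ 𝖾𝗆 _ := by
      rw [cross_crossInv_cross]; simp only [interchange, interchange_cross]
    _ = H ◁ (𝗎 _ ≫ 𝖽 _ ≫ 𝖽 _ ≫ H ◁ H ◁ 𝖼 _ ≫ (𝖼ᵢ _ ≫ H ◁ 𝖾𝗆 _)) ≫ 𝖽 _ ≫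
        H ◁ (𝖼 _ ≫ H ◁ 𝗆 _) ≫ 𝖾𝗆 _ := by
      rw [cross_annihilate]; simp only [interchange, interchange_cross]
    _ = H ◁ (𝗎 _ ≫ (𝖽 _ ≫ H ◁ 𝖽 _) ≫ H ◁ H ◁ 𝖼 _ ≫ H ◁ 𝖼 _ ≫ 𝖾𝗆 _) ≫ 𝖽 _ ≫
        H ◁ (𝖼 _ ≫ H ◁ 𝗆 _) ≫ 𝖾𝗆 _ := by
      rw [crossInv_annihilate, ← comul_assoc_word]; simp only [interchange]
    _ = H ◁ (𝗉 _ ≫ 𝖽 _) ≫ 𝖽 _ ≫ H ◁ (𝖼 _ ≫ H ◁ 𝗆 _) ≫ 𝖾𝗆 _ := by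
      rw [piL_comul_eq_word]; simp only [interchange]
    _ = H ◁ 𝗉 _ ≫ (𝗆 _ ≫ 𝖽 _) ≫ 𝖾 _ := by
      rw [mul_comul_word]; simp only [interchange, mul_counit_word]
    _ = _ := by rw [Category.assoc, comul_counit_left_word, Category.comp_id]

/-- `1₁ ⊗ 1₂ y = 1₁ ⊗ ε(1₂ y₁) y₂`. -/
theorem unit_mul_counit_word : 𝗎 _ ≫ 𝖽 _ ≫ H ◁ 𝗆 Z = 𝗎 _ ≫ 𝖽 _ ≫ H ◁ H ◁ 𝖽 _ ≫ H ◁ 𝖾𝗆 _ := by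
  symm
  calc
    _ = 𝗎 _ ≫ 𝖽 _ ≫ H ◁ (H ◁ (𝗎 _ ≫ (𝗆 _ ≫ 𝖽 _)) ≫ 𝖾𝗆 _) := by
      simp only [reassoc_of% unit_mul_word, interchange]
    _ = 𝗎 _ ≫ 𝖽 _ ≫ H ◁ (H ◁ (𝗎 _ ≫ H ◁ 𝖽 _ ≫ 𝖽 _ ≫ H ◁ 𝖼 _ ≫ H ◁ H ◁ 𝗆 _) ≫
        (H ◁ 𝗆 _ ≫ 𝖾𝗆 _)) := by
      rw [mul_comul_word]; simp only [interchange]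
    _ = 𝖽 _ ≫ (𝗎 _ ≫ 𝖽 _ ≫ H ◁ H ◁ 𝗎 _ ≫ H ◁ H ◁ 𝖽 _ ≫ H ◁ 𝗆 _) ≫
        H ◁ H ◁ (𝖼 _ ≫ H ◁ 𝗆 _) ≫ H ◁ 𝖾𝗆 _ := by
      rw [← counit_assoc_word]; simp only [interchange]
    _ = 𝗎 _ ≫ 𝖽 _ ≫ H ◁ ((H ◁ 𝖽 _ ≫ 𝖽 _ ≫ H ◁ 𝖼 _ ≫ H ◁ H ◁ 𝗆 _ ≫ 𝗆 _) ≫ 𝖾 _) := by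
      rw [← unit_weak_word]; simp only [interchange, mul_counit_word]
    _ = _ := by
      rw [← mul_comul_word, Category.assoc, comul_counit_left_word, Category.comp_id]

/-- `Π^L(x) y = ε(Π^L(x) y₁) y₂`. -/
theorem piL_mul_word : 𝗉 _ ≫ 𝗆 Z = 𝗉 _ ≫ H ◁ 𝖽 _ ≫ 𝖾𝗆 _ := by
  calc
    _ = H ◁ (𝗎 _ ≫ 𝖽 _ ≫ H ◁ 𝗆 Z) ≫ 𝖼ᵢ _ ≫ 𝖾𝗆 _ := by
      rw [piL_eq_braidInv_word]; simp only [interchange, interchange_cross]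
    _ = _ := by
      rw [unit_mul_counit_word, piL_eq_braidInv_word]
      simp only [interchange, interchange_cross]

/-- This form exhibits the pattern `ε(x h₁) h₂`, to which `counit_mul_comul_word` applies when `h`
is a product. -/
theorem comul_piL_word : 𝖽 Z ≫ 𝗉 _ = 𝗎 _ ≫ 𝖽 _ ≫ H ◁ (𝖼 _ ≫ 𝖽 _) ≫ 𝖾𝗆 _ ≫ 𝖼ᵢ _ := by
  symm
  calc
    _ = 𝗎 _ ≫ 𝖽 _ ≫ H ◁ (H ◁ 𝖽 _ ≫ 𝖼 _ ≫ H ◁ (𝖼 _ ≫ 𝖼ᵢ _)) ≫ 𝖾𝗆 _ := by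
      rw [← cross_split]; simp only [interchange]
    _ = _ := by
      rw [cross_crossInv, piL_eq_word]; simp only [interchange]

/-- `Π^L(h₁ k₁) ⊗ h₂ k₂ = Π^L(h₁) ⊗ h₂ k`. -/
theorem mul_comul_piL_word : 𝗆 Z ≫ 𝖽 _ ≫ 𝗉 _ = 𝖽 _ ≫ 𝗉 _ ≫ H ◁ 𝗆 Z := by
  calc
    _ = 𝗎 _ ≫ 𝖽 _ ≫ H ◁ ((H ◁ 𝗆 _ ≫ 𝖼 _) ≫ 𝖽 _) ≫ 𝖾𝗆 _ ≫ 𝖼ᵢ _ := by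
      rw [comul_piL_word]; simp only [interchange]
    _ = 𝗎 _ ≫ 𝖽 _ ≫ H ◁ (𝖼 _ ≫ H ◁ 𝖼 _) ≫ (H ◁ 𝗆 _ ≫ H ◁ 𝖽 _ ≫ 𝖾𝗆 _) ≫ 𝖼ᵢ _ := by
      rw [cross_merge]; simp only [interchange]
    _ = 𝗎 _ ≫ 𝖽 _ ≫ H ◁ (𝖼 _ ≫ H ◁ 𝖼 _) ≫ H ◁ 𝖽 _ ≫ 𝖾𝗆 _ ≫ 𝗆 _ ≫ 𝖼ᵢ _ := by
      rw [counit_mul_comul_word]; simp only [interchange]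
    _ = 𝗎 _ ≫ 𝖽 _ ≫ H ◁ (𝖼 _ ≫ 𝖽 _ ≫ H ◁ H ◁ (𝖼 _ ≫ 𝖼ᵢ _)) ≫ 𝖾𝗆 _ ≫ 𝖼ᵢ _ ≫ H ◁ 𝗆 _ := by
      rw [merge_crossInv]; simp only [interchange]
    _ = (𝖽 _ ≫ 𝗉 _) ≫ H ◁ 𝗆 _ := by
      rw [cross_crossInv, comul_piL_word]; simp only [interchange]
    _ = _ := Category.assoc _ _ _

/-- `(x Π^L(h₁)) h₂ = x h`. -/
theorem mul_piL_mul_word : H ◁ 𝖽 _ ≫ H ◁ 𝗉 _ ≫ 𝗆 _ ≫ 𝗆 Z = 𝗆 Z := by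
  calc
    _ = H ◁ 𝖽 _ ≫ (𝖽 _ ≫ H ◁ 𝖼 _ ≫ 𝖾𝗆 _) ≫ 𝗆 _ := by
      rw [← mul_piL_word]; simp only [interchange]
    _ = (H ◁ 𝖽 _ ≫ 𝖽 _ ≫ H ◁ 𝖼 _ ≫ H ◁ H ◁ 𝗆 _ ≫ 𝗆 _) ≫ 𝖾 _ := by
      simp only [interchange, mul_counit_word]
    _ = _ := by
      rw [← mul_comul_word, Category.assoc, comul_counit_left_word, Category.comp_id]

end Lemmas

end WeakHopfQuasigroup

section HopfModule

variable {C : Type u} [Category.{v} C] [MonoidalCategory C] [BraidedCategory C]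
variable (H : C) [WeakHopfQuasigroup H]

local notation "𝗆" => merge (mul H)
local notation "𝖽" => split (comul H)
local notation "𝗎" => create (unit H)
local notation "𝖾" => discard (counit H)
local notation "𝖾𝗆" => annihilate (mul H ≫ counit H)
local notation "𝗌" => onHead (antipode H)
local notation "𝗉" => onHead (piL H)
local notation "𝗋" => onHead (piR H)
local notation "𝖼" => cross H H
local notation "𝖼ᵢ" => crossInv H H

/-! ### Hopf module axioms in word form -/

section Words

variable {H} {X : C} (φ : X ⊗ H ⟶ X) (ρ : X ⟶ X ⊗ H)

theorem coact_counit_iff :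
    ρ ≫ X ◁ counit H = (ρ_ X).inv ↔ ∀ Z, split ρ Z ≫ X ◁ 𝖾 Z = 𝟙 _ := by
  rw [eq_iff_forall_whiskerRight]
  refine forall_congr' fun Z => ?_
  rw [← cancel_mono ((ρ_ X).hom ▷ Z)]
  convert Iff.rfl using 2
  · simp only [split, discard]; monoidal
  · simp

theorem coact_coassoc_iff :
    ρ ≫ ρ ▷ H ≫ (α_ X H H).hom = ρ ≫ X ◁ comul H ↔
      ∀ Z, split ρ Z ≫ split ρ _ = split ρ Z ≫ X ◁ 𝖽 Z := by
  rw [eq_iff_forall_whiskerRight]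
  refine forall_congr' fun Z => ?_
  rw [← cancel_mono ((α_ X (H ⊗ H) Z).hom ≫ X ◁ (α_ H H Z).hom)]
  convert Iff.rfl using 2 <;>
  simp only [split] <;> monoidal

theorem act_unit_iff :
    X ◁ unit H ≫ φ = (ρ_ X).hom ↔ ∀ Z, X ◁ 𝗎 Z ≫ merge φ Z = 𝟙 _ := by
  rw [eq_iff_forall_whiskerRight]
  refine forall_congr' fun Z => ?_
  rw [← cancel_epi ((ρ_ X).inv ▷ Z)]
  convert Iff.rfl using 2
  · simp only [create, merge]; monoidal
  · simp

theorem act_coact_iff :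
    φ ≫ ρ = (ρ ⊗ₘ comul H) ≫ tensorμ X H H H ≫ (φ ⊗ₘ mul H) ↔
      ∀ Z, merge φ Z ≫ split ρ Z =
        X ◁ 𝖽 Z ≫ split ρ _ ≫ X ◁ 𝖼 _ ≫ X ◁ H ◁ 𝗆 Z ≫ merge φ _ := by
  rw [eq_iff_forall_whiskerRight]
  refine forall_congr' fun Z => ?_
  rw [← cancel_mono (α_ X H Z).hom, ← cancel_epi (α_ X H Z).inv]
  convert Iff.rfl using 2
  · simp only [split, merge]; monoidal
  · simp only [split, merge, cross, MonoidalCategory.tensorHom_def', tensorμ]; monoidal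

theorem act_antipode_iff :
    X ◁ comul H ⊗≫ (φ ⊗ₘ antipode H) ≫ φ = X ◁ piL H ≫ φ ↔
      ∀ Z, X ◁ 𝖽 Z ≫ merge φ _ ≫ X ◁ 𝗌 Z ≫ merge φ Z = X ◁ 𝗉 Z ≫ merge φ Z := by
  rw [eq_iff_forall_whiskerRight]
  refine forall_congr' fun Z => ?_
  rw [← cancel_epi (α_ X H Z).inv]
  convert Iff.rfl using 2 <;>
  simp only [split, merge, onHead, MonoidalCategory.tensorHom_def] <;> monoidal

theorem antipode_act_iff :
    X ◁ comul H ⊗≫ (X ◁ antipode H) ▷ H ≫ φ ▷ H ≫ φ = X ◁ piR H ≫ φ ↔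
      ∀ Z, X ◁ 𝖽 Z ≫ X ◁ 𝗌 _ ≫ merge φ _ ≫ merge φ Z = X ◁ 𝗋 Z ≫ merge φ Z := by
  rw [eq_iff_forall_whiskerRight]
  refine forall_congr' fun Z => ?_
  rw [← cancel_epi (α_ X H Z).inv]
  convert Iff.rfl using 2 <;>
  simp only [split, merge, onHead] <;> monoidal

theorem piL_act_iff :
    X ◁ comul H ⊗≫ (X ◁ piL H) ▷ H ≫ φ ▷ H ≫ φ = φ ↔
      ∀ Z, X ◁ 𝖽 Z ≫ X ◁ 𝗉 _ ≫ merge φ _ ≫ merge φ Z = merge φ Z := by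
  rw [eq_iff_forall_whiskerRight]
  refine forall_congr' fun Z => ?_
  rw [← cancel_epi (α_ X H Z).inv]
  convert Iff.rfl using 2
  · simp only [split, merge, onHead]; monoidal
  · rfl

end Words

/-! ### Coinvariants and the projection `q` -/

namespace HopfModule

variable {H} (M : HopfModule H) (Z : C)

local notation "𝖺" => merge M.act
local notation "𝗏" => split M.coact
local notation "𝗊" => onHead M.q

theorem coact_counit_word : 𝗏 Z ≫ M.X ◁ 𝖾 Z = 𝟙 _ :=
  (coact_counit_iff _).1 M.isHopfModule.coact_counit Z

theorem coact_coassoc_word : 𝗏 Z ≫ 𝗏 _ = 𝗏 Z ≫ M.X ◁ 𝖽 Z :=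
  (coact_coassoc_iff _).1 M.isHopfModule.coact_coassoc Z

theorem act_unit_word : M.X ◁ 𝗎 Z ≫ 𝖺 Z = 𝟙 _ :=
  (act_unit_iff _).1 M.isHopfModule.act_unit Z

theorem act_coact_word :
    𝖺 Z ≫ 𝗏 Z = M.X ◁ 𝖽 Z ≫ 𝗏 _ ≫ M.X ◁ 𝖼 _ ≫ M.X ◁ H ◁ 𝗆 Z ≫ 𝖺 _ :=
  (act_coact_iff _ _).1 M.isHopfModule.act_coact Z

theorem act_antipode_word : M.X ◁ 𝖽 Z ≫ 𝖺 _ ≫ M.X ◁ 𝗌 Z ≫ 𝖺 Z = M.X ◁ 𝗉 Z ≫ 𝖺 Z :=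
  (act_antipode_iff _).1 M.isHopfModule.act_antipode Z

theorem antipode_act_word : M.X ◁ 𝖽 Z ≫ M.X ◁ 𝗌 _ ≫ 𝖺 _ ≫ 𝖺 Z = M.X ◁ 𝗋 Z ≫ 𝖺 Z :=
  (antipode_act_iff _).1 M.isHopfModule.antipode_act Z

theorem piL_act_word : M.X ◁ 𝖽 Z ≫ M.X ◁ 𝗉 _ ≫ 𝖺 _ ≫ 𝖺 Z = 𝖺 Z :=
  (piL_act_iff _).1 M.isHopfModule.piL_act Z

theorem q_word : 𝗊 Z = 𝗏 Z ≫ M.X ◁ 𝗌 Z ≫ 𝖺 Z := by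
  simp only [q, onHead, split, merge]; monoidal

/-- Since `Π^R(h) = 1₁ ε(h 1₂)`, the left side is `ρ(m 1)` with its `H`-leg killed by the counit. -/
theorem coact_piR_act_word : 𝗏 Z ≫ M.X ◁ 𝗋 Z ≫ 𝖺 Z = 𝟙 _ := by
  calc
    _ = M.X ◁ 𝗎 _ ≫ (M.X ◁ 𝖽 _ ≫ 𝗏 _ ≫ M.X ◁ 𝖼 _ ≫ M.X ◁ H ◁ 𝗆 _ ≫ 𝖺 _) ≫ M.X ◁ 𝖾 _ := by
      rw [piR_eq_word]; simp only [interchange, mul_counit_word]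
    _ = (M.X ◁ 𝗎 _ ≫ 𝖺 _) ≫ 𝗏 _ ≫ M.X ◁ 𝖾 _ := by
      rw [← act_coact_word]; simp only [interchange]
    _ = _ := by rw [act_unit_word, coact_counit_word, Category.comp_id]

/-- `q(m₀) m₁ = m`. -/
theorem coact_q_act_word : 𝗏 Z ≫ 𝗊 _ ≫ 𝖺 Z = 𝟙 _ := by
  calc
    _ = (𝗏 Z ≫ 𝗏 _) ≫ M.X ◁ 𝗌 _ ≫ 𝖺 _ ≫ 𝖺 _ := by
      rw [q_word]; simp only [interchange]
    _ = 𝗏 Z ≫ M.X ◁ 𝖽 _ ≫ M.X ◁ 𝗌 _ ≫ 𝖺 _ ≫ 𝖺 _ := by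
      rw [coact_coassoc_word, Category.assoc]
    _ = _ := by rw [antipode_act_word, coact_piR_act_word]

/-- `n₀ a₁ ⊗ n₁ Π^L(a₂) = n₀ a ⊗ n₁`. -/
theorem coact_act_mul_piL_word :
    M.X ◁ 𝖽 Z ≫ 𝗏 _ ≫ M.X ◁ 𝖼 _ ≫ M.X ◁ H ◁ (H ◁ 𝗉 _ ≫ 𝗆 Z) ≫ 𝖺 _ =
      𝗏 _ ≫ M.X ◁ 𝖼 _ ≫ 𝖺 _ := by
  calc
    -- By `x Π^L(y) = ε(x₁ y) x₂`, a factor `ε(n₁ a₂)` multiplies `n₀ a₁`. Together they are the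
    -- counit applied to `ρ(n₀ a)`.
    _ = M.X ◁ 𝖽 _ ≫ 𝗏 _ ≫ M.X ◁ ((𝖼 _ ≫ H ◁ 𝖽 _) ≫ H ◁ (H ◁ 𝖼 _ ≫ 𝖾𝗆 _)) ≫ 𝖺 _ := by
      rw [mul_piL_word]; simp only [interchange]
    _ = M.X ◁ 𝖽 _ ≫ (𝗏 _ ≫ M.X ◁ 𝖽 _) ≫
        M.X ◁ (H ◁ 𝖼 _ ≫ 𝖼 _ ≫ H ◁ (H ◁ 𝖼 _ ≫ 𝖾𝗆 _)) ≫ 𝖺 _ := by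
      rw [← split_cross]; simp only [interchange]
    _ = 𝗏 _ ≫ M.X ◁ (H ◁ 𝖽 _ ≫ 𝖼 _ ≫ H ◁ 𝖼 _) ≫ 𝗏 _ ≫ M.X ◁ 𝖼 _ ≫ M.X ◁ H ◁ 𝖾𝗆 _ ≫ 𝖺 _ := by
      rw [← coact_coassoc_word]; simp only [interchange, interchange_cross]
    _ = 𝗏 _ ≫ M.X ◁ 𝖼 _ ≫
        (M.X ◁ 𝖽 _ ≫ 𝗏 _ ≫ M.X ◁ 𝖼 _ ≫ M.X ◁ H ◁ 𝗆 _ ≫ 𝖺 _) ≫ M.X ◁ 𝖾 _ := by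
      rw [cross_split]; simp only [interchange, mul_counit_word]
    _ = _ := by
      rw [← act_coact_word, Category.assoc, coact_counit_word, Category.comp_id]

/-- `ρ(m Π^L(a)) = m₀ Π^L(a) ⊗ m₁`. -/
theorem piL_act_coact_word :
    M.X ◁ 𝗉 Z ≫ 𝖺 Z ≫ 𝗏 Z = M.X ◁ 𝗉 Z ≫ 𝗏 _ ≫ M.X ◁ 𝖼 _ ≫ 𝖺 _ := by
  calc
    _ = M.X ◁ (𝗉 Z ≫ 𝖽 _) ≫ 𝗏 _ ≫ M.X ◁ 𝖼 _ ≫ M.X ◁ H ◁ 𝗆 _ ≫ 𝖺 _ := by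
      rw [act_coact_word]; simp only [interchange]
    _ = M.X ◁ 𝗉 Z ≫ M.X ◁ 𝖽 Z ≫ 𝗏 _ ≫ M.X ◁ 𝖼 _ ≫ M.X ◁ H ◁ (H ◁ 𝗉 _ ≫ 𝗆 Z) ≫ 𝖺 _ := by
      rw [← piL_comul_word]; simp only [interchange, interchange_cross]
    _ = _ := by rw [coact_act_mul_piL_word]

/-- `m₀ ⊗ Π^L(m₁) = q(m₀)₀ m₁ ⊗ q(m₀)₁`. -/
theorem coact_piL_word : 𝗏 Z ≫ M.X ◁ 𝗉 Z = 𝗏 Z ≫ 𝗊 _ ≫ 𝗏 _ ≫ M.X ◁ 𝖼 _ ≫ 𝖺 _ := by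
  calc
    _ = (𝗏 _ ≫ M.X ◁ 𝖽 _) ≫ M.X ◁ H ◁ 𝗌 _ ≫ M.X ◁ 𝗆 _ := by
      rw [piL_word]; simp only [interchange]
    -- Replacing `m` by `q(m₀) m₁` before the coaction produces `(q(m₀)₁ m₂) λ(m₃)`, which the
    -- antipode axiom of `H` reduces to `q(m₀)₁ Π^L(m₂)`.
    _ = 𝗏 _ ≫ (𝗏 _ ≫ 𝗊 _ ≫ 𝖺 _) ≫ 𝗏 _ ≫ M.X ◁ H ◁ 𝗌 _ ≫ M.X ◁ 𝗆 _ := by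
      rw [← coact_coassoc_word, coact_q_act_word]; simp only [interchange]
    _ = (𝗏 _ ≫ 𝗏 _) ≫ 𝗊 _ ≫ (𝖺 _ ≫ 𝗏 _) ≫ M.X ◁ H ◁ 𝗌 _ ≫ M.X ◁ 𝗆 _ := by
      simp only [interchange]
    _ = 𝗏 _ ≫ 𝗊 _ ≫ M.X ◁ (𝖽 _ ≫ 𝖽 _) ≫ 𝗏 _ ≫ M.X ◁ 𝖼 _ ≫
        M.X ◁ H ◁ (𝗆 _ ≫ H ◁ 𝗌 _ ≫ 𝗆 _) ≫ 𝖺 _ := by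
      rw [act_coact_word, coact_coassoc_word]; simp only [interchange]
    _ = 𝗏 _ ≫ 𝗊 _ ≫ M.X ◁ 𝖽 _ ≫ 𝗏 _ ≫ M.X ◁ 𝖼 _ ≫
        M.X ◁ H ◁ (H ◁ 𝖽 _ ≫ 𝗆 _ ≫ H ◁ 𝗌 _ ≫ 𝗆 _) ≫ 𝖺 _ := by
      rw [comul_assoc_word]; simp only [interchange, interchange_cross]
    _ = _ := by rw [mul_antipode_right_word, coact_act_mul_piL_word]

/-- `q(m₀) Π^L(m₁) = q(m)`. -/
theorem coact_q_piL_act_word : 𝗏 Z ≫ 𝗊 _ ≫ M.X ◁ 𝗉 Z ≫ 𝖺 Z = 𝗊 Z := by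
  calc
    _ = (𝗏 Z ≫ M.X ◁ 𝖽 _) ≫ 𝗊 _ ≫ 𝖺 _ ≫ M.X ◁ 𝗌 _ ≫ 𝖺 _ := by
      rw [← act_antipode_word]; simp only [interchange]
    _ = 𝗏 Z ≫ (𝗏 _ ≫ 𝗊 _ ≫ 𝖺 _) ≫ M.X ◁ 𝗌 _ ≫ 𝖺 _ := by
      rw [← coact_coassoc_word]; simp only [interchange]
    _ = _ := by rw [coact_q_act_word, Category.id_comp, q_word]

/-- `ρ(q(m)) = m₀ λ(m₂) ⊗ Π^L(m₁)`. -/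
theorem q_coact_eq_word :
    𝗊 Z ≫ 𝗏 Z = 𝗏 _ ≫ 𝗏 _ ≫ M.X ◁ 𝗉 _ ≫ M.X ◁ 𝖼 _ ≫ M.X ◁ 𝗌 _ ≫ 𝖺 _ := by
  symm
  calc
    _ = 𝗏 _ ≫ (𝗏 _ ≫ 𝗊 _ ≫ 𝗏 _ ≫ M.X ◁ 𝖼 _ ≫ 𝖺 _) ≫ M.X ◁ 𝖼 _ ≫ M.X ◁ 𝗌 _ ≫ 𝖺 _ := by
      rw [← coact_piL_word]; simp only [interchange]
    _ = (𝗏 _ ≫ 𝗏 _) ≫ 𝗊 _ ≫ 𝗏 _ ≫ M.X ◁ (𝖼 _ ≫ H ◁ 𝖼 _) ≫ 𝖺 _ ≫ M.X ◁ 𝗌 _ ≫ 𝖺 _ := by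
      simp only [interchange]
    _ = 𝗏 _ ≫ 𝗊 _ ≫ 𝗏 _ ≫ M.X ◁ (H ◁ 𝖽 _ ≫ 𝖼 _ ≫ H ◁ 𝖼 _) ≫ 𝖺 _ ≫ M.X ◁ 𝗌 _ ≫ 𝖺 _ := by
      rw [coact_coassoc_word]; simp only [interchange]
    _ = 𝗏 _ ≫ 𝗊 _ ≫ 𝗏 _ ≫ M.X ◁ 𝖼 _ ≫ M.X ◁ 𝖽 _ ≫ 𝖺 _ ≫ M.X ◁ 𝗌 _ ≫ 𝖺 _ := by
      rw [cross_split]; simp only [interchange]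
    _ = 𝗏 _ ≫ 𝗊 _ ≫ 𝗏 _ ≫ M.X ◁ (𝖼 _ ≫ 𝗉 _) ≫ 𝖺 _ := by
      rw [act_antipode_word]; simp only [interchange]
    _ = 𝗏 _ ≫ 𝗊 _ ≫ M.X ◁ 𝗉 _ ≫ 𝗏 _ ≫ M.X ◁ 𝖼 _ ≫ 𝖺 _ := by
      rw [cross_onHead]; simp only [interchange]
    _ = (𝗏 Z ≫ 𝗊 _ ≫ M.X ◁ 𝗉 Z ≫ 𝖺 Z) ≫ 𝗏 _ := by
      rw [← piL_act_coact_word]; simp only [interchange]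
    _ = _ := by rw [coact_q_piL_act_word]

/-- `ρ(q(m)) = q(m)₀ ⊗ Π^L(q(m)₁)`. -/
theorem q_coact_piL_word : 𝗊 Z ≫ 𝗏 Z ≫ M.X ◁ 𝗉 Z = 𝗊 Z ≫ 𝗏 Z := by
  calc
    _ = (𝗊 Z ≫ 𝗏 Z) ≫ M.X ◁ 𝗉 Z := by rw [Category.assoc]
    _ = 𝗏 _ ≫ 𝗏 _ ≫ M.X ◁ (𝗉 _ ≫ (𝖼 _ ≫ H ◁ 𝗉 _) ≫ 𝗌 _) ≫ 𝖺 _ := by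
      rw [q_coact_eq_word]; simp only [interchange]
    _ = 𝗏 _ ≫ 𝗏 _ ≫ M.X ◁ ((𝗉 _ ≫ 𝗉 _) ≫ 𝖼 _ ≫ 𝗌 _) ≫ 𝖺 _ := by
      rw [← onHead_cross]; simp only [interchange]
    _ = _ := by
      rw [piL_idem_word, q_coact_eq_word]; simp only [interchange]

/-- `ρ(n h) = n h₁ ⊗ h₂` for `n` in the image of `q`. -/
theorem q_act_coact_word : 𝗊 _ ≫ 𝖺 Z ≫ 𝗏 Z = 𝗊 _ ≫ M.X ◁ 𝖽 Z ≫ 𝖺 _ := by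
  calc
    _ = (𝗊 _ ≫ 𝗏 _) ≫ M.X ◁ H ◁ 𝖽 _ ≫ M.X ◁ 𝖼 _ ≫ M.X ◁ H ◁ 𝗆 _ ≫ 𝖺 _ := by
      rw [act_coact_word]; simp only [interchange]
    -- As `Π^L` fixes the leg `n₁`, the product `n₁ h₂` equals `ε(n₁ h₂) h₃`. The counit then
    -- collapses the coaction of `n h₁`.
    _ = 𝗊 _ ≫ 𝗏 _ ≫ M.X ◁ H ◁ 𝖽 _ ≫ M.X ◁ (𝗉 _ ≫ 𝖼 _) ≫ M.X ◁ H ◁ 𝗆 _ ≫ 𝖺 _ := by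
      rw [← q_coact_piL_word]; simp only [interchange]
    _ = 𝗊 _ ≫ 𝗏 _ ≫ M.X ◁ H ◁ 𝖽 _ ≫ M.X ◁ 𝖼 _ ≫ M.X ◁ H ◁ (𝗉 _ ≫ 𝗆 _) ≫ 𝖺 _ := by
      rw [onHead_cross]; simp only [interchange]
    _ = 𝗊 _ ≫ 𝗏 _ ≫ M.X ◁ H ◁ (𝖽 _ ≫ H ◁ 𝖽 _) ≫ M.X ◁ (𝖼 _ ≫ H ◁ 𝗉 _) ≫
        M.X ◁ H ◁ 𝖾𝗆 _ ≫ 𝖺 _ := by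
      rw [piL_mul_word]; simp only [interchange, interchange_cross]
    _ = (𝗊 _ ≫ 𝗏 _ ≫ M.X ◁ 𝗉 _) ≫ M.X ◁ H ◁ (𝖽 _ ≫ H ◁ 𝖽 _) ≫ M.X ◁ 𝖼 _ ≫ M.X ◁ H ◁ 𝖾𝗆 _ ≫
        𝖺 _ := by
      rw [← onHead_cross]; simp only [interchange]
    _ = 𝗊 _ ≫ M.X ◁ 𝖽 _ ≫
        (M.X ◁ 𝖽 _ ≫ 𝗏 _ ≫ M.X ◁ 𝖼 _ ≫ M.X ◁ H ◁ 𝗆 _ ≫ 𝖺 _) ≫ M.X ◁ 𝖾 _ := by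
      rw [q_coact_piL_word, ← comul_assoc_word]; simp only [interchange, mul_counit_word]
    _ = _ := by
      rw [← act_coact_word, Category.assoc, coact_counit_word, Category.comp_id]

/-- `q(n h) = n Π^L(h)` for `n` in the image of `q`. -/
theorem q_act_q_word : 𝗊 _ ≫ 𝖺 Z ≫ 𝗊 Z = 𝗊 _ ≫ M.X ◁ 𝗉 Z ≫ 𝖺 Z := by
  calc
    _ = (𝗊 _ ≫ 𝖺 _ ≫ 𝗏 _) ≫ M.X ◁ 𝗌 _ ≫ 𝖺 _ := by rw [M.q_word Z]; simp only [interchange]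
    _ = _ := by rw [q_act_coact_word, ← act_antipode_word]; simp only [interchange]

/-- Take `h = 1` in `q(n h) = n Π^L(h)`, since `Π^L(1) = 1`. -/
theorem q_idem_word : 𝗊 Z ≫ 𝗊 Z = 𝗊 Z := by
  calc
    _ = 𝗊 _ ≫ (M.X ◁ 𝗎 _ ≫ 𝖺 _) ≫ 𝗊 _ := by rw [act_unit_word, Category.id_comp]
    _ = M.X ◁ 𝗎 _ ≫ 𝗊 _ ≫ 𝖺 _ ≫ 𝗊 _ := by simp only [interchange]
    _ = 𝗊 _ ≫ M.X ◁ (𝗎 _ ≫ 𝗉 _) ≫ 𝖺 _ := by rw [q_act_q_word]; simp only [interchange]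
    _ = _ := by rw [unit_comp_piL_word, act_unit_word, Category.comp_id]

/-- The action `m ⊗ h ↦ q(m₀) (m₁ h)`. -/
def qAct : M.X ⊗ H ⟶ M.X :=
  (M.coact ≫ M.q ▷ H) ▷ H ≫ (α_ M.X H H).hom ≫ M.X ◁ mul H ≫ M.act

local notation "𝖻" => merge M.qAct

theorem qAct_word : 𝖻 Z = 𝗏 _ ≫ 𝗊 _ ≫ M.X ◁ 𝗆 _ ≫ 𝖺 Z := by
  simp only [qAct, onHead, split, merge]; monoidal

/-- `(n h) · k = n (h k)` for `n` in the image of `q`, where `·` is `qAct`. -/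
theorem q_act_qAct_word : 𝗊 _ ≫ 𝖺 _ ≫ 𝖻 Z = 𝗊 _ ≫ M.X ◁ 𝗆 _ ≫ 𝖺 Z := by
  calc
    _ = (𝗊 _ ≫ 𝖺 _ ≫ 𝗏 _) ≫ 𝗊 _ ≫ M.X ◁ 𝗆 _ ≫ 𝖺 _ := by rw [qAct_word]; simp only [interchange]
    _ = M.X ◁ 𝖽 _ ≫ (𝗊 _ ≫ 𝖺 _ ≫ 𝗊 _) ≫ M.X ◁ 𝗆 _ ≫ 𝖺 _ := by
      rw [q_act_coact_word]; simp only [interchange]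
    _ = 𝗊 _ ≫ M.X ◁ (𝖽 _ ≫ 𝗉 _ ≫ H ◁ 𝗆 _) ≫ 𝖺 _ ≫ 𝖺 _ := by
      rw [q_act_q_word]; simp only [interchange]
    -- The element is now `(n Π^L(h₁))(h₂ k)`. Rewriting `Π^L(h₁) ⊗ h₂ k` through the coproduct of
    -- `h k` puts it in the form absorbed by the last Hopf module axiom.
    _ = 𝗊 _ ≫ M.X ◁ 𝗆 _ ≫ (M.X ◁ 𝖽 _ ≫ M.X ◁ 𝗉 _ ≫ 𝖺 _ ≫ 𝖺 _) := by
      rw [← mul_comul_piL_word]; simp only [interchange]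
    _ = _ := by rw [piL_act_word]

theorem q_qAct_word : 𝗊 _ ≫ 𝖻 Z = 𝗊 _ ≫ 𝖺 Z := by
  calc
    _ = 𝗊 _ ≫ (M.X ◁ 𝗎 _ ≫ 𝖺 _) ≫ 𝖻 _ := by rw [act_unit_word, Category.id_comp]
    _ = M.X ◁ 𝗎 _ ≫ 𝗊 _ ≫ 𝖺 _ ≫ 𝖻 _ := by simp only [interchange]
    _ = 𝗊 _ ≫ M.X ◁ (𝗎 _ ≫ 𝗆 _) ≫ 𝖺 _ := by
      rw [q_act_qAct_word]; simp only [interchange]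
    _ = _ := by rw [unit_mul_word]; simp only [interchange]

/-- Both multiplications happen in `H`, so axioms for two successive actions reduce to the
corresponding identities of `H`. -/
theorem qAct_qAct_word : 𝖻 _ ≫ 𝖻 Z = 𝗏 _ ≫ 𝗊 _ ≫ M.X ◁ (𝗆 _ ≫ 𝗆 _) ≫ 𝖺 Z := by
  calc
    _ = 𝗏 _ ≫ M.X ◁ 𝗆 _ ≫ 𝗊 _ ≫ 𝖺 _ ≫ 𝖻 _ := by
      rw [M.qAct_word (H ⊗ Z)]; simp only [interchange]
    _ = _ := by rw [q_act_qAct_word]; simp only [interchange]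

theorem isHopfModule_qAct : IsHopfModule H M.qAct M.coact where
  coact_counit := M.isHopfModule.coact_counit
  coact_coassoc := M.isHopfModule.coact_coassoc
  act_unit := (act_unit_iff _).2 fun Z => by
    calc
      _ = 𝗏 _ ≫ 𝗊 _ ≫ M.X ◁ (H ◁ 𝗎 _ ≫ 𝗆 _) ≫ 𝖺 _ := by
        rw [qAct_word]; simp only [interchange]
      _ = _ := by rw [mul_unit_word, whiskerLeft_id, Category.id_comp, coact_q_act_word]
  act_coact := (act_coact_iff _ _).2 fun Z => by
    calc
      _ = 𝗏 _ ≫ M.X ◁ 𝗆 _ ≫ (𝗊 _ ≫ 𝖺 _ ≫ 𝗏 _) := by rw [qAct_word]; simp only [interchange]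
      _ = 𝗏 _ ≫ 𝗊 _ ≫ M.X ◁ (𝗆 _ ≫ 𝖽 _) ≫ 𝖺 _ := by
        rw [q_act_coact_word]; simp only [interchange]
      _ = (𝗏 _ ≫ M.X ◁ 𝖽 _) ≫ 𝗊 _ ≫
          M.X ◁ (H ◁ H ◁ 𝖽 _ ≫ H ◁ 𝖼 _ ≫ H ◁ H ◁ 𝗆 _ ≫ 𝗆 _) ≫ 𝖺 _ := by
        rw [mul_comul_word]; simp only [interchange]
      _ = _ := by
        rw [← coact_coassoc_word, qAct_word]; simp only [interchange]
  act_antipode := (act_antipode_iff _).2 fun Z => by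
    calc
      _ = M.X ◁ 𝖽 _ ≫ M.X ◁ H ◁ 𝗌 _ ≫ (𝖻 _ ≫ 𝖻 _) := by simp only [interchange]
      _ = 𝗏 _ ≫ 𝗊 _ ≫ M.X ◁ (H ◁ 𝖽 Z ≫ 𝗆 _ ≫ H ◁ 𝗌 Z ≫ 𝗆 Z) ≫ 𝖺 _ := by
        rw [qAct_qAct_word]; simp only [interchange]
      _ = _ := by rw [mul_antipode_right_word, qAct_word]; simp only [interchange]
  antipode_act := (antipode_act_iff _).2 fun Z => by
    calc
      _ = 𝗏 _ ≫ 𝗊 _ ≫ M.X ◁ (H ◁ 𝖽 Z ≫ H ◁ 𝗌 _ ≫ 𝗆 _ ≫ 𝗆 Z) ≫ 𝖺 _ := by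
        rw [qAct_qAct_word]; simp only [interchange]
      _ = _ := by rw [antipode_mul_right_word, qAct_word]; simp only [interchange]
  piL_act := (piL_act_iff _).2 fun Z => by
    calc
      _ = 𝗏 _ ≫ 𝗊 _ ≫ M.X ◁ (H ◁ 𝖽 Z ≫ H ◁ 𝗉 _ ≫ 𝗆 _ ≫ 𝗆 Z) ≫ 𝖺 _ := by
        rw [qAct_qAct_word]; simp only [interchange]
      _ = _ := by rw [mul_piL_mul_word, qAct_word]

theorem q_comp_q : M.q ≫ M.q = M.q :=
  eq_iff_forall_whiskerRight.2 fun Z => by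
    rw [comp_whiskerRight]; exact M.q_idem_word Z

theorem coact_q_act : M.coact ≫ M.q ▷ H ≫ M.act = 𝟙 _ :=
  eq_iff_forall_whiskerRight.2 fun Z => by
    rw [id_whiskerRight, ← M.coact_q_act_word Z]
    simp only [onHead, split, merge]; monoidal

/-- The Hopf module with the action of `M` replaced by `qAct`. -/
abbrev reAct : HopfModule H where
  X := M.X
  act := M.qAct
  coact := M.coact
  isHopfModule := M.isHopfModule_qAct

/-- Computed with `qAct`, the projection is `q(m₀)(m₁ λ(m₂)) = q(m₀) Π^L(m₁)`, which is `q(m)`. -/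
theorem reAct_q : M.reAct.q = M.q :=
  eq_iff_forall_whiskerRight.2 fun Z => by
    calc
      _ = 𝗏 Z ≫ M.X ◁ 𝗌 Z ≫ 𝖻 Z := M.reAct.q_word Z
      _ = (𝗏 _ ≫ 𝗏 _) ≫ M.X ◁ H ◁ 𝗌 _ ≫ 𝗊 _ ≫ M.X ◁ 𝗆 _ ≫ 𝖺 _ := by
        rw [qAct_word]; simp only [interchange]
      _ = 𝗏 _ ≫ 𝗊 _ ≫ M.X ◁ (𝖽 _ ≫ H ◁ 𝗌 _ ≫ 𝗆 _) ≫ 𝖺 _ := by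
        rw [coact_coassoc_word]; simp only [interchange]
      _ = _ := by rw [← piL_word, coact_q_piL_act_word]; rfl

/-- As `q` is unchanged, only the outer action differs. It is applied to elements `q(m₀)`, on which
`qAct` and the original action agree. -/
theorem reAct_qAct : M.reAct.qAct = M.qAct :=
  merge_injective <| by
    calc
      _ = 𝗏 _ ≫ onHead (A := M.X) (B := M.X) M.reAct.q _ ≫ M.X ◁ 𝗆 _ ≫ 𝖻 (𝟙_ C) :=
        M.reAct.qAct_word _
      _ = 𝗏 _ ≫ M.X ◁ 𝗆 _ ≫ 𝗊 _ ≫ 𝖻 _ := by rw [reAct_q]; simp only [interchange]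
      _ = 𝖻 _ := by rw [q_qAct_word, M.qAct_word]; simp only [interchange]

end HopfModule

end HopfModule

theorem nonempty_splitting {C : Type u} [Category.{v} C] [IsIdempotentComplete C] {X : C}
    {f : X ⟶ X} (hf : f ≫ f = f) : Nonempty (Splitting f) := by
  obtain ⟨Y, i, p, h₁, h₂⟩ := IsIdempotentComplete.idempotents_split X f hf
  exact ⟨⟨Y, i, p, h₁, h₂⟩⟩

/-! ### Transport along `α` and the fundamental theorem -/

section FundamentalTheorem

variable {C : Type u} [Category.{v} C] [MonoidalCategory C] [BraidedCategory C]
variable {H : C} [WeakHopfQuasigroup H]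

theorem IsHopfModule.of_iso {X Y : C} {φ : X ⊗ H ⟶ X} {ρ : X ⟶ X ⊗ H} {φ' : Y ⊗ H ⟶ Y}
    {ρ' : Y ⟶ Y ⊗ H} (h : IsHopfModule H φ ρ) (e : X ≅ Y) (hρ : e.hom ≫ ρ' = ρ ≫ e.hom ▷ H)
    (hφ : e.hom ▷ H ≫ φ' = φ ≫ e.hom) : IsHopfModule H φ' ρ' := by
  have merge_word (Z : C) : onHead e.hom _ ≫ merge φ' Z = merge φ Z ≫ onHead e.hom Z := by
    calc
      _ = (α_ X H Z).inv ≫ (e.hom ▷ H ≫ φ') ▷ Z := by simp only [onHead, merge]; monoidal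
      _ = _ := by rw [hφ]; simp only [onHead, merge]; monoidal
  have split_word (Z : C) : onHead e.hom Z ≫ split ρ' Z = split ρ Z ≫ onHead e.hom _ := by
    calc
      _ = (e.hom ≫ ρ') ▷ Z ≫ (α_ Y H Z).hom := by simp only [onHead, split]; monoidal
      _ = _ := by rw [hρ]; simp only [onHead, split]; monoidal
  have (Z : C) : IsIso (onHead e.hom Z) := inferInstanceAs (IsIso (e.hom ▷ Z))
  constructor
  · refine (coact_counit_iff _).2 fun Z => (cancel_epi (onHead e.hom _)).1 ?_
    calc
      _ = (onHead e.hom Z ≫ split ρ' Z) ≫ Y ◁ discard (counit H) Z := by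
        simp only [interchange]
      _ = (split ρ Z ≫ X ◁ discard (counit H) Z) ≫ onHead e.hom _ := by
        rw [split_word]; simp only [interchange]
      _ = _ := by rw [(coact_counit_iff _).1 h.coact_counit Z]; simp only [interchange]
  · refine (coact_coassoc_iff _).2 fun Z => (cancel_epi (onHead e.hom _)).1 ?_
    calc
      _ = (split ρ Z ≫ split ρ _) ≫ onHead e.hom _ := by
        rw [reassoc_of% split_word, split_word, Category.assoc]
      _ = _ := by
        rw [(coact_coassoc_iff _).1 h.coact_coassoc Z, reassoc_of% split_word]
        simp only [interchange]
  · refine (act_unit_iff _).2 fun Z => (cancel_epi (onHead e.hom _)).1 ?_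
    calc
      _ = X ◁ create (unit H) Z ≫ onHead e.hom _ ≫ merge φ' Z := by simp only [interchange]
      _ = (X ◁ create (unit H) Z ≫ merge φ Z) ≫ onHead e.hom _ := by
        rw [merge_word]; simp only [interchange]
      _ = _ := by rw [(act_unit_iff _).1 h.act_unit Z]; simp only [interchange]
  · refine (act_coact_iff _ _).2 fun Z => (cancel_epi (onHead e.hom _)).1 ?_
    calc
      _ = (merge φ Z ≫ split ρ Z) ≫ onHead e.hom _ := by
        rw [reassoc_of% merge_word, split_word, Category.assoc]
      _ = X ◁ split (comul H) Z ≫ split ρ _ ≫ X ◁ cross H H _ ≫ X ◁ H ◁ merge (mul H) Z ≫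
          onHead e.hom _ ≫ merge φ' _ := by
        rw [(act_coact_iff _ _).1 h.act_coact Z, merge_word]; simp only [Category.assoc]
      _ = X ◁ split (comul H) Z ≫ (split ρ _ ≫ onHead e.hom _) ≫ Y ◁ cross H H _ ≫
          Y ◁ H ◁ merge (mul H) Z ≫ merge φ' _ := by simp only [interchange]
      _ = _ := by rw [← split_word]; simp only [interchange]
  · refine (act_antipode_iff _).2 fun Z => (cancel_epi (onHead e.hom _)).1 ?_
    calc
      _ = X ◁ split (comul H) Z ≫ (onHead e.hom _ ≫ merge φ' _) ≫ Y ◁ onHead (antipode H) Z ≫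
          merge φ' Z := by simp only [interchange]
      _ = X ◁ split (comul H) Z ≫ merge φ _ ≫ X ◁ onHead (antipode H) Z ≫
          (onHead e.hom _ ≫ merge φ' Z) := by rw [merge_word]; simp only [interchange]
      _ = (X ◁ split (comul H) Z ≫ merge φ _ ≫ X ◁ onHead (antipode H) Z ≫ merge φ Z) ≫
          onHead e.hom _ := by rw [merge_word]; simp only [Category.assoc]
      _ = X ◁ onHead (piL H) Z ≫ (merge φ Z ≫ onHead e.hom _) := by
        rw [(act_antipode_iff _).1 h.act_antipode Z, Category.assoc]
      _ = _ := by rw [← merge_word]; simp only [interchange]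
  · refine (antipode_act_iff _).2 fun Z => (cancel_epi (onHead e.hom _)).1 ?_
    calc
      _ = X ◁ split (comul H) Z ≫ X ◁ onHead (antipode H) _ ≫
          (onHead e.hom _ ≫ merge φ' _) ≫ merge φ' Z := by simp only [interchange]
      _ = (X ◁ split (comul H) Z ≫ X ◁ onHead (antipode H) _ ≫ merge φ _ ≫ merge φ Z) ≫
          onHead e.hom _ := by rw [merge_word, Category.assoc, merge_word]; simp only [interchange]
      _ = X ◁ onHead (piR H) Z ≫ (merge φ Z ≫ onHead e.hom _) := by
        rw [(antipode_act_iff _).1 h.antipode_act Z, Category.assoc]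
      _ = _ := by rw [← merge_word]; simp only [interchange]
  · refine (piL_act_iff _).2 fun Z => (cancel_epi (onHead e.hom _)).1 ?_
    calc
      _ = X ◁ split (comul H) Z ≫ X ◁ onHead (piL H) _ ≫
          (onHead e.hom _ ≫ merge φ' _) ≫ merge φ' Z := by simp only [interchange]
      _ = (X ◁ split (comul H) Z ≫ X ◁ onHead (piL H) _ ≫ merge φ _ ≫ merge φ Z) ≫
          onHead e.hom _ := by rw [merge_word, Category.assoc, merge_word]; simp only [interchange]
      _ = _ := by rw [(piL_act_iff _).1 h.piL_act Z, merge_word]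

namespace HopfModule

section Strict

variable {M N : HopfModule H} {f : M.X ⟶ N.X} (hρ : f ≫ N.coact = M.coact ≫ f ▷ H)
  (hφ : f ▷ H ≫ N.act = M.act ≫ f)

include hρ hφ

theorem comp_q_of_strict : f ≫ N.q = M.q ≫ f := by
  rw [q, q, reassoc_of% hρ, ← whisker_exchange_assoc, hφ]
  simp only [Category.assoc]

theorem whiskerRight_comp_qAct_of_strict : f ▷ H ≫ N.qAct = M.qAct ≫ f := by
  calc
    _ = (f ≫ N.coact) ▷ H ≫ N.q ▷ H ▷ H ≫ (α_ N.X H H).hom ≫ N.X ◁ mul H ≫ N.act := by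
      simp only [qAct, comp_whiskerRight, Category.assoc]
    _ = M.coact ▷ H ≫ (f ≫ N.q) ▷ H ▷ H ≫ (α_ N.X H H).hom ≫ N.X ◁ mul H ≫ N.act := by
      rw [hρ]; simp only [comp_whiskerRight, Category.assoc]
    _ = M.coact ▷ H ≫ M.q ▷ H ▷ H ≫ (α_ M.X H H).hom ≫ f ▷ (H ⊗ H) ≫ N.X ◁ mul H ≫ N.act := by
      rw [comp_q_of_strict hρ hφ]
      simp only [comp_whiskerRight, Category.assoc, associator_naturality_left_assoc]
    _ = _ := by
      rw [← whisker_exchange_assoc, hφ]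
      simp only [qAct, comp_whiskerRight, Category.assoc]

end Strict

variable (M : HopfModule H) (s : Splitting M.q)

/-- This is `q(m₀) m₁ = m`; the splitting enters only through its composite `q`. -/
theorem omega'_comp_omega : M.omega' s ≫ M.omega s = 𝟙 _ := by
  rw [omega', omega, Category.assoc, ← comp_whiskerRight_assoc, s.p_i, coact_q_act]

theorem nabla_eq : M.nabla s = M.omega s ≫ M.omega' s := by
  simp only [nabla, omega, omega', Category.assoc]

theorem nabla_comp_nabla : M.nabla s ≫ M.nabla s = M.nabla s := by
  simp only [nabla_eq, Category.assoc, reassoc_of% omega'_comp_omega M s]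

variable (t : Splitting (M.nabla s))

theorem alpha_comp_i : M.alpha s t ≫ t.i = M.omega' s := by
  rw [alpha, Category.assoc, t.p_i, nabla_eq, reassoc_of% omega'_comp_omega M s]

theorem p_comp_alphaInv : t.p ≫ M.alphaInv s t = M.omega s := by
  rw [alphaInv, reassoc_of% t.p_i, nabla_eq, Category.assoc, omega'_comp_omega, Category.comp_id]

/-- `α_M` as an isomorphism of underlying objects. -/
@[simps]
def alphaIso : M.X ≅ t.obj where
  hom := M.alpha s t
  inv := M.alphaInv s t
  hom_inv_id := by rw [alpha, Category.assoc, p_comp_alphaInv, omega'_comp_omega]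
  inv_hom_id := by
    calc
      _ = t.i ≫ M.nabla s ≫ t.p := by
        simp only [alphaInv, alpha, nabla_eq, Category.assoc]
      _ = t.i ≫ (t.p ≫ t.i) ≫ t.p := congrArg (fun k => t.i ≫ k ≫ t.p) t.p_i.symm
      _ = _ := by rw [Category.assoc, t.i_p, Category.comp_id, t.i_p]

theorem alpha_comp_timesCoact : M.alpha s t ≫ M.timesCoact s t = M.coact ≫ M.alpha s t ▷ H := by
  calc
    _ = (M.coact ≫ M.X ◁ comul H) ≫ s.p ▷ (H ⊗ H) ≫ (α_ s.obj H H).inv ≫ t.p ▷ H := by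
      rw [timesCoact, reassoc_of% alpha_comp_i, omega', Category.assoc, Category.assoc,
        whisker_exchange_assoc]
    _ = _ := by
      rw [← M.isHopfModule.coact_coassoc, alpha, omega']
      simp

/-- The right side involves neither `s` nor `t`, so the transported action does not depend on the
splittings chosen in `actAlpha`. -/
theorem alpha_timesAct_alphaInv :
    M.alpha s t ▷ H ≫ M.timesAct s t ≫ M.alphaInv s t = M.qAct := by
  calc
    _ = (M.alpha s t ≫ t.i) ▷ H ≫ (α_ s.obj H H).hom ≫ s.obj ◁ mul H ≫
        t.p ≫ M.alphaInv s t := by simp only [timesAct, comp_whiskerRight, Category.assoc]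
    _ = M.coact ▷ H ≫ (s.p ≫ s.i) ▷ H ▷ H ≫ (α_ M.X H H).hom ≫ M.X ◁ mul H ≫ M.act := by
      rw [alpha_comp_i, p_comp_alphaInv, omega', omega, whisker_exchange_assoc]
      simp
    _ = _ := by rw [s.p_i, qAct, comp_whiskerRight, Category.assoc]

theorem alpha_comp_timesAct : M.alpha s t ▷ H ≫ M.timesAct s t = M.qAct ≫ M.alpha s t := by
  rw [← alpha_timesAct_alphaInv M s t, Category.assoc, Category.assoc, ← alphaIso_hom,
    ← alphaIso_inv, Iso.inv_hom_id, Category.comp_id]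

theorem isHopfModule_times : IsHopfModule H (M.timesAct s t) (M.timesCoact s t) :=
  M.isHopfModule_qAct.of_iso (M.alphaIso s t) (M.alpha_comp_timesCoact s t)
    (M.alpha_comp_timesAct s t)

theorem actAlpha_eq_qAct [IsIdempotentComplete C] : M.actAlpha = M.qAct := by
  have h : Nonempty (Σ s : Splitting M.q, Splitting (M.nabla s)) := by
    obtain ⟨s⟩ := nonempty_splitting M.q_comp_q
    obtain ⟨t⟩ := nonempty_splitting (M.nabla_comp_nabla s)
    exact ⟨⟨s, t⟩⟩
  rw [actAlpha, dif_pos h, alpha_timesAct_alphaInv]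

end HopfModule

end FundamentalTheorem

end WeakHopf

open WeakHopf HopfModule in
theorem mainTheorem1 {C : Type u} [Category.{v} C] [MonoidalCategory C] [BraidedCategory C]
    [IsIdempotentComplete C] (H : C) [WeakHopf.WeakHopfQuasigroup H]
    (M : WeakHopf.HopfModule H) :
    M.q ≫ M.q = M.q ∧
    ∀ s : WeakHopf.Splitting M.q,
      M.nabla s ≫ M.nabla s = M.nabla s ∧
      ∀ t : WeakHopf.Splitting (M.nabla s),
        ∃ h : WeakHopf.IsHopfModule H (M.timesAct s t) (M.timesCoact s t),
        ∃ e : M ≅ (⟨t.obj, M.timesAct s t, M.timesCoact s t, h⟩ : WeakHopf.HopfModule H),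
          e.hom.hom = M.alpha s t ∧ e.inv.hom = M.alphaInv s t := by
  refine ⟨M.q_comp_q, fun s => ⟨M.nabla_comp_nabla s, fun t => ⟨M.isHopfModule_times s t, ?_⟩⟩⟩
  let N : HopfModule H := ⟨t.obj, M.timesAct s t, M.timesCoact s t, M.isHopfModule_times s t⟩
  let α : M.X ≅ N.X := M.alphaIso s t
  have comodule : α.hom ≫ N.coact = M.coact ≫ α.hom ▷ H := M.alpha_comp_timesCoact s t
  have quasilinear : α.hom ▷ H ≫ N.actAlpha = M.actAlpha ≫ α.hom := by
    -- The map `α` is strictly linear from `M.reAct`, not from `M`, so the quasi-action of `M` is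
    -- first rewritten as that of `M.reAct`.
    rw [actAlpha_eq_qAct, actAlpha_eq_qAct, ← M.reAct_qAct]
    exact whiskerRight_comp_qAct_of_strict (M := M.reAct) comodule (M.alpha_comp_timesAct s t)
  let f : HopfModule.Hom M N := ⟨α.hom, comodule, quasilinear⟩
  let g : HopfModule.Hom N M := ⟨α.inv, by
      rw [← cancel_epi α.hom, reassoc_of% comodule]
      simp, by
      rw [← cancel_epi (α.hom ▷ H), reassoc_of% quasilinear]
      simp⟩
  exact ⟨⟨f, g, HopfModule.Hom.ext α.hom_inv_id, HopfModule.Hom.ext α.inv_hom_id⟩, rfl, rfl⟩
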